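/- **Setting.** Let $\mathfrak o$ be a complete discrete valuation ring with maximal ideal $\mathfrak p$ and finite residue field, $\ell\in\mathbb N$, $\mathfrak o_\ell=\mathfrak o/\mathfrak p^\ell$, $R$ a finite (not necessarily commutative) $\mathfrak o_\ell$-algebra, and $K$ an algebraically closed field of characteristic $0$. Let $M\cong M_1^{a_1}\oplus\cdots\oplus M_n^{a_n}$ be a finite $R$-module, where $M_1,\dots,M_n$ are pairwise non-isomorphic indecomposable $R$-modules and all $a_i\geq 1$. Let $\mathcal C=\langle M_1,\dots,M_n\rangle$ be the full subcategory of $R$-modules isomorphic to some $\bigoplus_i M_i^{b_i}$, $b_i\in\mathbb N$, and let $\mathcal C_{+1}$ be the category of $\mathfrak o_\ell$-linear functors from $\mathcal C$ to finite $\mathfrak o_\ell$-modules. For $X\in\mathcal C$ put $F_X=\operatorname{Hom}_R(X,-)\in\mathcal C_{+1}$; by Yoneda's lemma $\operatorname{Aut}_R(X)\cong\operatorname{Aut}(F_X)$, where $g$ corresponds to precomposition with $g^{-1}$. For $F\in\mathcal C_{+1}$ let $KF(M)$ be the permutation representation of $\operatorname{Aut}_R(M)$ on the vector space with basis $\{u_x\}_{x\in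 F(M)}$. Write $G\prec F$ if $G\in\mathcal C_{+1}$ is isomorphic to a subquotient of $F$ but not to $F$, and let $\overline{KF(M)}$ be the largest subrepresentation of $KF(M)$ with $\operatorname{Hom}_{\operatorname{Aut}_R(M)}(KG(M),\overline{KF(M)})=0$ for all $G\prec F$. Let $V$ be an irreducible representation of $\operatorname{Aut}_R(M)$ over $K$. We say that $(M,V)$ functor-morphs to $(F,\widetilde V)$, written $(M,V)\leadsto(F,\widetilde V)$, if $V$ is a subrepresentation of $KF(M)$ but not of $KG(M)$ for any $G\prec F$, and $\widetilde V\cong\operatorname{Hom}_{\operatorname{Aut}_R(M)}(\overline{KF(M)},V)$ as representations of $\operatorname{Aut}(F)$, where $\alpha\in\operatorname{Aut}(F)$ acts by $(\alpha f)(x)=f(\alpha^{-1}x)$. Put $$\deg(M,V)=(\dim V,|\operatorname{Aut}_R(M)|,\operatorname{Supp}(M)),\qquad \deg(F,\widetilde V)=(\dim\widetilde V,|\operatorname{Aut}(F)|,\operatorname{Supp}(F)),$$ elements of $\mathbb N^3$ with the lexicographic order, where $\operatorname{Supp}$ is the number of isomorphism classes of indecomposable direct summands. **Theorem.** Suppose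 that $(M,V)\leadsto(F,\widetilde V)$. 1. $\deg(M,V)\geq\deg(F,\widetilde V)$. 2. If $\deg(M,V)=\deg(F,\widetilde V)$, then $F\cong F_M$; and for every isomorphism $F\cong F_M$ the representations $V$ and $\widetilde V$ are isomorphic with respect to the resulting identification $\operatorname{Aut}_R(M)\cong\operatorname{Aut}(F_M)\cong\operatorname{Aut}(F)$. 3. Call $a\in F(M)$ *generic* if $V^{\operatorname{Stab}(a)}\neq0$, where $\operatorname{Stab}(a)$ is the stabiliser of $a$ in $\operatorname{Aut}_R(M)$. The generic points form exactly one $\operatorname{Aut}_R(M)$-orbit in $F(M)$. If $a$ is generic and $H=\operatorname{Stab}(a)$, then $\widetilde V\cong V^H$, where $\alpha\in\operatorname{Aut}(F)$ acts on $V^H$ as any $g\in\operatorname{Aut}_R(M)$ with $g\cdot a=\alpha^{-1}(a)$. 4. There is an exact sequence $\operatorname{Hom}_R(Y,-)\xrightarrow{f^*}\operatorname{Hom}_R(X,-)\xrightarrow{p}F\to0$ with $X,Y\in\mathcal C$ and $f:X\to Y$, in which $\operatorname{Hom}_R(X,-)$ is a projective cover of $F$ and $\operatorname{Hom}_R(Y,-)$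 is a projective cover of $\ker p$. For every such sequence: * $X$ is a direct summand of $M$; * every endomorphism $x$ of $X$ with $p\circ x^*=\varphi\circ p$ for some $\varphi\in\operatorname{Aut}(F)$ is an automorphism, and $1+gf$ is an automorphism of $X$ for every $g:Y\to X$; * let $A_F\leq\operatorname{Aut}_R(X)$ be the group of all $x$ such that $p\circ x^*=\varphi\circ p$ for some $\varphi\in\operatorname{Aut}(F)$, and let $B_F=\{1+gf\mid g:Y\to X\}$; then $B_F$ is a normal subgroup of $A_F$, and $A_F/B_F\cong\operatorname{Aut}(F)$, the class of $x$ corresponding to the automorphism $\varphi$ with $p\circ(x^{-1})^*=\varphi\circ p$; * if $\deg(M,V)=\deg(F,\widetilde V)$, then $Y=0$ and $X\cong M$. -/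

import Mathlib

open CategoryTheory CategoryTheory.Limits Opposite

universe u v w

namespace FunctorMorphing

noncomputable section

/-! ### Generalities: direct summands and the support of an object -/

/-- `Y` is a direct summand of `X`. -/
def IsDirectSummand {D : Type*} [Category D] [HasZeroMorphisms D] [HasBinaryBiproducts D]
    (Y X : D) : Prop :=
  ∃ Z : D, Nonempty (X ≅ Y ⊞ Z)

/-- The number of isomorphism classes of indecomposable direct summands of `X`. -/
def supp {D : Type*} [Category D] [HasZeroMorphisms D] [HasBinaryBiproducts D] (X : D) : ℕ :=
  Set.ncard {c : Quotient (isIsomorphicSetoid D) |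
    ∃ Y : D, Quotient.mk _ Y = c ∧ Indecomposable Y ∧ IsDirectSummand Y X}

/-! ### Automorphisms -/

section Automorphisms

variable {D : Type*} [Category D] {X : D}

/-- An element of the automorphism group of `X`, viewed as an isomorphism `X ≅ X`. -/
def toIso (g : Aut X) : X ≅ X := g

@[simp] theorem toIso_one_hom : (toIso (1 : Aut X)).hom = 𝟙 X := rfl

@[simp] theorem toIso_mul_hom (g h : Aut X) :
    (toIso (g * h)).hom = (toIso h).hom ≫ (toIso g).hom := rfl

@[simp] theorem toIso_inv_hom (g : Aut X) : (toIso g⁻¹).hom = (toIso g).inv := rfl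

end Automorphisms

/-! ### The category `𝒞` generated by modules `N₁, …, Nₙ`, and its linear structure -/

section Category

/-- An `A`-algebra `R` acts on `R`-modules, which are thus `A`-modules. -/
abbrev moduleOfAlgebra (A : Type w) [CommRing A] {R : Type u} [Ring R] [Algebra A R]
    (X : ModuleCat.{v} R) : Module A X :=
  Module.restrictScalars A R X

/-- For an `A`-algebra `R` the category of `R`-modules is `A`-linear. -/
instance linearOfAlgebra (A : Type w) [CommRing A] {R : Type u} [Ring R] [Algebra A R] :
    Linear A (ModuleCat.{v} R) where
  homModule X Y :=
    letI := moduleOfAlgebra A Y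
    haveI : IsScalarTower A R Y := IsScalarTower.restrictScalars A R Y
    inferInstance
  smul_comp := by
    intro X Y Z r f g
    ext x
    exact g.hom.map_smul (algebraMap A R r) (f.hom x)

variable {R : Type u} [Ring R] {n : ℕ}

/-- `X` is isomorphic to `⨁ᵢ Nᵢ ^ bᵢ` for some natural numbers `bᵢ`. -/
def IsSumOf (N : Fin n → ModuleCat.{v} R) : ObjectProperty (ModuleCat.{v} R) :=
  fun X => ∃ b : Fin n → ℕ, Nonempty (X ≃ₗ[R] ((i : Fin n) → (Fin (b i) → N i)))

/-- The full subcategory `𝒞 = ⟨N₁, …, Nₙ⟩` of `R`-modules. -/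
abbrev SumCat (N : Fin n → ModuleCat.{v} R) := (IsSumOf N).FullSubcategory

end Category

variable {A : Type w} [CommRing A] {R : Type u} [Ring R] [Algebra A R] {n : ℕ}
variable {N : Fin n → ModuleCat.{v} R}

/-! ### The category `𝒞₊₁` of linear functors -/

/-- `F` is an object of `𝒞₊₁`: an `A`-linear functor from `𝒞` to (finite) `A`-modules. The
morphisms of `𝒞₊₁` are all natural transformations, and subfunctors, quotient functors and direct
summands of objects of `𝒞₊₁` (among all functors) are again in `𝒞₊₁`. -/
structure IsLinearFunctor (F : SumCat N ⥤ ModuleCat.{v} A) : Prop where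
  additive : F.Additive
  linear : F.Linear A
  finite : ∀ X, Finite (F.obj X)

/-- `F ≼ G`: the functor `F` is isomorphic to a subquotient of `G`. -/
def Subquot (F G : SumCat N ⥤ ModuleCat.{v} A) : Prop :=
  ∃ (H : SumCat N ⥤ ModuleCat.{v} A) (i : H ⟶ G) (q : H ⟶ F), Mono i ∧ Epi q

/-- `F ≺ G`: `F ≼ G`, and `F` is not isomorphic to `G`. -/
def StrictSubquot (F G : SumCat N ⥤ ModuleCat.{v} A) : Prop :=
  Subquot F G ∧ IsEmpty (F ≅ G)

variable (A) in
/-- The functor `F_X = Hom_R(X, -)` on `𝒞`. -/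
abbrev homFun (X : SumCat N) : SumCat N ⥤ ModuleCat.{v} A :=
  (linearCoyoneda A (SumCat N)).obj (op X)

variable (A) in
/-- The morphism `f^* : Hom(Y, -) ⟶ Hom(X, -)` given by precomposition with `f : X ⟶ Y`. -/
abbrev homFunMap {X Y : SumCat N} (f : X ⟶ Y) : homFun A Y ⟶ homFun A X :=
  (linearCoyoneda A (SumCat N)).map f.op

variable (A) in
/-- The isomorphism `Aut_R(X) ≃ Aut(F_X)` given by the Yoneda lemma; it sends `g` to
precomposition with `g⁻¹`. -/
def yonedaAut (X : SumCat N) : Aut X ≃* Aut (homFun A X) where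
  toFun g := ((linearCoyoneda A (SumCat N)).mapIso (Iso.op (toIso g).symm) : homFun A X ≅ homFun A X)
  invFun α := Iso.symm
    (Iso.unop ((linearCoyoneda A (SumCat N)).preimageIso (toIso α)))
  left_inv g := by
    apply Iso.ext
    change ((linearCoyoneda A (SumCat N)).preimage (homFunMap A (toIso g).hom)).unop = (toIso g).hom
    rw [homFunMap, Functor.preimage_map, Quiver.Hom.unop_op]
  right_inv α := by
    apply Iso.ext
    change homFunMap A ((linearCoyoneda A (SumCat N)).preimage (toIso α).hom).unop = (toIso α).hom
    rw [homFunMap, Quiver.Hom.op_unop, Functor.map_preimage]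
  map_mul' g h := by
    apply Iso.ext
    change homFunMap A ((toIso g).inv ≫ (toIso h).inv) =
      homFunMap A (toIso h).inv ≫ homFunMap A (toIso g).inv
    rw [homFunMap, op_comp, Functor.map_comp]

/-! ### The representations `KF(M)` and their top layers -/

variable (K : Type*) [Field K]

/-- The permutation representation `KF(M)` of `Aut_R(M)`. -/
def permRep (F : SumCat N ⥤ ModuleCat.{v} A) (M : SumCat N) :
    Representation K (Aut M) (F.obj M →₀ K) where
  toFun g := Finsupp.lmapDomain K K (F.map (toIso g).hom)
  map_one' := by
    change Finsupp.lmapDomain K K (F.map (𝟙 M)) = _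
    ext x
    simp
  map_mul' g h := by
    change Finsupp.lmapDomain K K (F.map ((toIso h).hom ≫ (toIso g).hom)) =
      Finsupp.lmapDomain K K (F.map (toIso g).hom) * Finsupp.lmapDomain K K (F.map (toIso h).hom)
    ext x
    simp

/-- The action `α ↦ α_*` of `Aut(F)` on `KF(M)`. -/
def autRep (F : SumCat N ⥤ ModuleCat.{v} A) (M : SumCat N) :
    Representation K (Aut F) (F.obj M →₀ K) where
  toFun α := Finsupp.lmapDomain K K ((toIso α).hom.app M)
  map_one' := by
    change Finsupp.lmapDomain K K ((𝟙 F : F ⟶ F).app M) = _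
    ext x
    simp
  map_mul' α β := by
    change Finsupp.lmapDomain K K (((toIso β).hom ≫ (toIso α).hom).app M) =
      Finsupp.lmapDomain K K ((toIso α).hom.app M) * Finsupp.lmapDomain K K ((toIso β).hom.app M)
    ext x
    simp

/-- The subrepresentations `U` of `KF(M)` with `Hom(KG(M), U) = 0` for every `G ≺ F`. -/
def IsReduced (F : SumCat N ⥤ ModuleCat.{v} A) (M : SumCat N)
    (U : Subrepresentation (permRep K F M)) : Prop :=
  ∀ G : SumCat N ⥤ ModuleCat.{v} A, IsLinearFunctor G → StrictSubquot G F →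
    ∀ φ : (permRep K G M).IntertwiningMap U.toRepresentation, φ = 0

/-- The largest subrepresentation `U` of `KF(M)` such that `Hom(KG(M), U) = 0` for every `G ≺ F`
(the sum of all of them). -/
def topLayer (F : SumCat N ⥤ ModuleCat.{v} A) (M : SumCat N) :
    Subrepresentation (permRep K F M) where
  toSubmodule := ⨆ (U : Subrepresentation (permRep K F M)) (_ : IsReduced K F M U), U.toSubmodule
  apply_mem_toSubmodule g := by
    suffices h : (⨆ (U : Subrepresentation (permRep K F M)) (_ : IsReduced K F M U),
        U.toSubmodule) ≤ (⨆ (U : Subrepresentation (permRep K F M)) (_ : IsReduced K F M U),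
        U.toSubmodule).comap (permRep K F M g) from fun v hv => h hv
    refine iSup₂_le fun U hU x hx => ?_
    exact (le_iSup₂_of_le (f := fun (U : Subrepresentation (permRep K F M))
      (_ : IsReduced K F M U) => U.toSubmodule) U hU le_rfl) (U.apply_mem_toSubmodule g hx)

set_option linter.unusedSectionVars false in
/-- The actions of `Aut(F)` and of `Aut_R(M)` on `KF(M)` commute. -/
theorem autRep_comm (F : SumCat N ⥤ ModuleCat.{v} A) (M : SumCat N) (α : Aut F) (g : Aut M)
    (x : F.obj M →₀ K) :
    autRep K F M α (permRep K F M g x) = permRep K F M g (autRep K F M α x) := by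
  simp only [autRep, permRep, MonoidHom.coe_mk, OneHom.coe_mk, Finsupp.lmapDomain_apply,
    ← Finsupp.mapDomain_comp]
  congr 1
  ext y
  simp only [Function.comp_apply, ← ConcreteCategory.comp_apply, NatTrans.naturality]

/-- The image of a subrepresentation of `KF(M)` under an automorphism of `F`. -/
def mapAut (F : SumCat N ⥤ ModuleCat.{v} A) (M : SumCat N) (α : Aut F)
    (U : Subrepresentation (permRep K F M)) : Subrepresentation (permRep K F M) where
  toSubmodule := U.toSubmodule.map (autRep K F M α)
  apply_mem_toSubmodule g := by
    rintro _ ⟨x, hx, rfl⟩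
    exact ⟨_, U.apply_mem_toSubmodule g hx, autRep_comm K F M α g x⟩

theorem IsReduced.mapAut {F : SumCat N ⥤ ModuleCat.{v} A} {M : SumCat N} (α : Aut F)
    {U : Subrepresentation (permRep K F M)} (hU : IsReduced K F M U) :
    IsReduced K F M (mapAut K F M α U) := by
  intro G hG hGF φ
  have key : ∀ x : (FunctorMorphing.mapAut K F M α U).toSubmodule,
      autRep K F M α⁻¹ (x : F.obj M →₀ K) ∈ U.toSubmodule := by
    rintro ⟨_, y, hy, rfl⟩
    simpa [← Module.End.mul_apply, ← map_mul] using hy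
  let ψ : (permRep K G M).IntertwiningMap U.toRepresentation :=
    { toFun := fun x => ⟨autRep K F M α⁻¹ (φ x : F.obj M →₀ K), key _⟩
      map_add' := fun x y => by ext1; simp
      map_smul' := fun c x => by ext1; simp
      isIntertwining' := fun g => by
        ext1 x
        apply LinearMap.ext
        intro c
        apply Subtype.ext
        change autRep K F M α⁻¹ (φ (permRep K G M g (Finsupp.lsingle x c)) : F.obj M →₀ K) =
          permRep K F M g (autRep K F M α⁻¹ (φ (Finsupp.lsingle x c) : F.obj M →₀ K))
        rw [← autRep_comm, φ.isIntertwining]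
        rfl }
  have hψ : ψ = 0 := hU G hG hGF ψ
  apply Representation.IntertwiningMap.ext
  apply LinearMap.ext
  intro x
  apply Subtype.ext
  have h1 : autRep K F M α⁻¹ (φ x : F.obj M →₀ K) = 0 :=
    congrArg Subtype.val (DFunLike.congr_fun hψ x)
  have h2 := congrArg (autRep K F M α) h1
  simpa [← Module.End.mul_apply, ← map_mul] using h2

theorem autRep_mem_topLayer (F : SumCat N ⥤ ModuleCat.{v} A) (M : SumCat N) (α : Aut F)
    {x : F.obj M →₀ K} (hx : x ∈ (topLayer K F M).toSubmodule) :
    autRep K F M α x ∈ (topLayer K F M).toSubmodule := by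
  suffices h : (topLayer K F M).toSubmodule ≤
      (topLayer K F M).toSubmodule.comap (autRep K F M α) from h hx
  refine iSup₂_le fun U hU x hx => ?_
  exact (le_iSup₂_of_le (f := fun (U : Subrepresentation (permRep K F M))
    (_ : IsReduced K F M U) => U.toSubmodule) (mapAut K F M α U) (hU.mapAut K α) le_rfl)
      ⟨x, hx, rfl⟩

/-- The action of `Aut(F)` on the top layer of `KF(M)`. -/
def topLayerAutRep (F : SumCat N ⥤ ModuleCat.{v} A) (M : SumCat N) :
    Representation K (Aut F) (topLayer K F M).toSubmodule where
  toFun α := (autRep K F M α).restrict fun _ hx => autRep_mem_topLayer K F M α hx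
  map_one' := by ext1 x; apply Subtype.ext; simp
  map_mul' α β := by ext1 x; apply Subtype.ext; simp

/-! ### Functor morphing -/

variable {K} {M : SumCat N} {V : Type*} [AddCommGroup V] [Module K V]

/-- The irreducible representation `V` of `Aut_R(M)` is `F`-typical: it is a subrepresentation of
`KF(M)`, and it is not a subrepresentation of `KG(M)` for any `G ≺ F`. -/
def IsTypical (ρ : Representation K (Aut M) V) (F : SumCat N ⥤ ModuleCat.{v} A) : Prop :=
  (∃ φ : ρ.IntertwiningMap (permRep K F M), Function.Injective φ) ∧
    ∀ G : SumCat N ⥤ ModuleCat.{v} A, IsLinearFunctor G → StrictSubquot G F →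
      ¬ ∃ φ : ρ.IntertwiningMap (permRep K G M), Function.Injective φ

/-- The space of `Aut_R(M)`-homomorphisms from the top layer of `KF(M)` to `V`, as a representation
of `Aut(F)`: an automorphism `α` acts by `(α f)(x) = f(α⁻¹ x)`. -/
def morphRep (ρ : Representation K (Aut M) V) (F : SumCat N ⥤ ModuleCat.{v} A) :
    Representation K (Aut F) ((topLayer K F M).toRepresentation.IntertwiningMap ρ) where
  toFun α :=
    { toFun := fun f =>
        { toLinearMap := f.toLinearMap ∘ₗ topLayerAutRep K F M α⁻¹
          isIntertwining' := fun g => by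
            apply LinearMap.ext
            intro x
            change f (topLayerAutRep K F M α⁻¹ ((topLayer K F M).toRepresentation g x)) =
              ρ g (f (topLayerAutRep K F M α⁻¹ x))
            rw [← f.isIntertwining]
            congr 1
            exact Subtype.ext (autRep_comm K F M α⁻¹ g x) }
      map_add' := fun f f' => rfl
      map_smul' := fun c f => rfl }
  map_one' := by
    ext1 f
    apply Representation.IntertwiningMap.ext
    change f.toLinearMap ∘ₗ topLayerAutRep K F M 1⁻¹ = f.toLinearMap
    rw [inv_one, map_one]
    rfl
  map_mul' α β := by
    ext1 f
    apply Representation.IntertwiningMap.ext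
    change f.toLinearMap ∘ₗ topLayerAutRep K F M (α * β)⁻¹ =
      (f.toLinearMap ∘ₗ topLayerAutRep K F M β⁻¹) ∘ₗ topLayerAutRep K F M α⁻¹
    rw [mul_inv_rev, map_mul]
    rfl

/-- The functor morphing relation `(M, V) ⤳ (F, W)`: the representation `V` of `Aut_R(M)` is
`F`-typical, and `W` is the representation `Hom(top layer of KF(M), V)` of `Aut(F)`, that is, the
dual of the multiplicity space of `V` in the top layer of `KF(M)`. -/
structure FunctorMorphs (ρ : Representation K (Aut M) V) (F : SumCat N ⥤ ModuleCat.{v} A)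
    {W : Type*} [AddCommGroup W] [Module K W] (σ : Representation K (Aut F) W) : Prop where
  isLinearFunctor : IsLinearFunctor F
  isTypical : IsTypical ρ F
  nonempty_equiv : Nonempty (σ.Equiv (morphRep ρ F))

/-! ### Degrees -/

/-- `deg(M, V) = (dim V, |Aut_R(M)|, Supp(M))` in `ℕ³` with the lexicographic order. -/
def degM (_ρ : Representation K (Aut M) V) : ℕ ×ₗ (ℕ ×ₗ ℕ) :=
  toLex (Module.finrank K V, toLex (Nat.card (Aut M), supp M.obj))

/-- `deg(F, W) = (dim W, |Aut(F)|, Supp(F))` in `ℕ³` with the lexicographic order. -/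
def degF {F : SumCat N ⥤ ModuleCat.{v} A} {W : Type*} [AddCommGroup W] [Module K W]
    (_σ : Representation K (Aut F) W) : ℕ ×ₗ (ℕ ×ₗ ℕ) :=
  toLex (Module.finrank K W, toLex (Nat.card (Aut F), supp F))

/-! ### Generic points -/

/-- The stabiliser in `Aut_R(M)` of a point `a` of `F(M)`. -/
def stab (F : SumCat N ⥤ ModuleCat.{v} A) (a : F.obj M) : Subgroup (Aut M) where
  carrier := {g | F.map (toIso g).hom a = a}
  one_mem' := by
    change F.map (𝟙 M) a = a
    simp
  mul_mem' {g h} hg hh := by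
    change F.map ((toIso h).hom ≫ (toIso g).hom) a = a
    replace hg : F.map (toIso g).hom a = a := hg
    replace hh : F.map (toIso h).hom a = a := hh
    rw [Functor.map_comp, ConcreteCategory.comp_apply, hh, hg]
  inv_mem' {g} hg := by
    change F.map (toIso g).inv a = a
    replace hg : F.map (toIso g).hom a = a := hg
    conv_lhs => rw [← hg]
    rw [← ConcreteCategory.comp_apply, ← Functor.map_comp, Iso.hom_inv_id, CategoryTheory.Functor.map_id,
      ConcreteCategory.id_apply]

/-- The space `V^H` of vectors fixed by a subgroup `H`. -/
def fixedSpace (ρ : Representation K (Aut M) V) (H : Subgroup (Aut M)) : Submodule K V :=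
  Representation.invariants (ρ.comp H.subtype)

/-- `a` is a generic point of `F(M)` for `V`: its stabiliser has a non-zero fixed vector in `V`. -/
def IsGeneric (ρ : Representation K (Aut M) V) (F : SumCat N ⥤ ModuleCat.{v} A)
    (a : F.obj M) : Prop :=
  fixedSpace ρ (stab F a) ≠ ⊥

/-! ### Minimal presentations -/

/-- An epimorphism `p : P ⟶ F` such that no proper direct summand of `P` maps onto `F`. For
`P = Hom(X, -)`, which is projective in `𝒞₊₁`, this says that `p` is a projective cover. -/
def IsCover {P F : SumCat N ⥤ ModuleCat.{v} A} (p : P ⟶ F) : Prop :=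
  Epi p ∧ ∀ (Q : SumCat N ⥤ ModuleCat.{v} A) (s : Retract Q P), Epi (s.i ≫ p) → IsIso s.i

/-- An exact sequence `Hom(Y, -) ⟶ Hom(X, -) ⟶ F ⟶ 0`, the first map being `f^*` and the second
`p`, in which `Hom(X, -)` is a projective cover of `F` and `Hom(Y, -)` is a projective cover of
`ker p`. -/
structure IsMinimalPresentation {F : SumCat N ⥤ ModuleCat.{v} A} {X Y : SumCat N} (f : X ⟶ Y)
    (p : homFun A X ⟶ F) : Prop where
  isCover : IsCover p
  comp_eq_zero : homFunMap A f ≫ p = 0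
  isCover_kernel : IsCover (kernel.lift p (homFunMap A f) comp_eq_zero)

/-- The group `A_F` of all automorphisms `x` of `X` such that `x^*` lifts an automorphism of `F`
along `p : Hom(X, -) ⟶ F`. -/
def groupA {F : SumCat N ⥤ ModuleCat.{v} A} {X : SumCat N} (p : homFun A X ⟶ F) :
    Subgroup (Aut X) where
  carrier := {x | ∃ φ : Aut F, homFunMap A (toIso x).hom ≫ p = p ≫ (toIso φ).hom}
  one_mem' := ⟨1, by
    change homFunMap A (𝟙 X) ≫ p = p ≫ 𝟙 F
    rw [homFunMap, op_id, CategoryTheory.Functor.map_id, Category.id_comp, Category.comp_id]⟩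
  mul_mem' {x y} hx hy := by
    obtain ⟨φ, hφ⟩ := hx
    obtain ⟨ψ, hψ⟩ := hy
    refine ⟨ψ * φ, ?_⟩
    change homFunMap A ((toIso y).hom ≫ (toIso x).hom) ≫ p = p ≫ (toIso φ).hom ≫ (toIso ψ).hom
    replace hφ : homFunMap A (toIso x).hom ≫ p = p ≫ (toIso φ).hom := hφ
    replace hψ : homFunMap A (toIso y).hom ≫ p = p ≫ (toIso ψ).hom := hψ
    rw [homFunMap, op_comp, Functor.map_comp, Category.assoc, hψ, ← Category.assoc, hφ,
      Category.assoc]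
  inv_mem' {x} hx := by
    obtain ⟨φ, hφ⟩ := hx
    refine ⟨φ⁻¹, ?_⟩
    change homFunMap A (toIso x).inv ≫ p = p ≫ (toIso φ).inv
    replace hφ : homFunMap A (toIso x).hom ≫ p = p ≫ (toIso φ).hom := hφ
    rw [Iso.eq_comp_inv, Category.assoc, ← hφ, ← Category.assoc, homFunMap, homFunMap,
      ← Functor.map_comp, ← op_comp, Iso.hom_inv_id, op_id, CategoryTheory.Functor.map_id,
      Category.id_comp]

/-- The group `B_F` of all automorphisms of `X` of the form `1 + g f` with `g : Y ⟶ X`. -/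
def groupB {X Y : SumCat N} (f : X ⟶ Y) : Subgroup (Aut X) where
  carrier := {x | ∃ g : Y ⟶ X, (toIso x).hom = 𝟙 X + f ≫ g}
  one_mem' := ⟨0, by
    change 𝟙 X = _
    rw [comp_zero, add_zero]⟩
  mul_mem' {x y} hx hy := by
    obtain ⟨g, hg⟩ := hx
    obtain ⟨h, hh⟩ := hy
    refine ⟨g + h + h ≫ f ≫ g, ?_⟩
    change (toIso y).hom ≫ (toIso x).hom = _
    replace hg : (toIso x).hom = 𝟙 X + f ≫ g := hg
    replace hh : (toIso y).hom = 𝟙 X + f ≫ h := hh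
    rw [hg, hh]
    simp only [Preadditive.add_comp, Preadditive.comp_add, Category.id_comp, Category.comp_id,
      Category.assoc]
    abel
  inv_mem' {x} hx := by
    obtain ⟨g, hg⟩ := hx
    refine ⟨-(g ≫ (toIso x).inv), ?_⟩
    change (toIso x).inv = _
    have h : f ≫ g = (toIso x).hom - 𝟙 X := by
      rw [show (toIso x).hom = 𝟙 X + f ≫ g from hg]
      abel
    rw [Preadditive.comp_neg, ← Category.assoc, h, Preadditive.sub_comp, Iso.hom_inv_id,
      Category.id_comp]
    abel

end

end FunctorMorphing

open FunctorMorphing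

namespace FunctorMorphing

/-! ### Finite rings and finite modules -/

section FiniteRing

/-! For an `F`-typical `V`, the generic points of `F(M)` are exactly the points that generate `F` as
a functor, and these form one orbit; everything else is read off from this. If `Stab(a)` fixes a
non-zero vector of `V`, then by Frobenius reciprocity and Maschke `V` embeds in `KG(M)`, where `G`
is the subfunctor of `F` generated by `a`. Typicality gives `G ≅ F`, and finiteness gives `G = F`
(`IsTypical.isGenerator`). On the other hand, let `p : Hom(X, -) ⟶ F` be a projective cover and `pt
p` the point of `F(X)` that corresponds to it. A generator `a` has the form `F(s)(pt p)` for a split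
monomorphism `s : X ⟶ M` (`IsCover.exists_split`), and finite modules cancel from direct sums
(`nonempty_equiv_of_prod_equiv`), so any two such `s` differ by an automorphism of `M`.

Maschke identifies the maps from the top layer to `V` with the maps from all of `KF(M)`, and
evaluation at a generic `a` identifies these with `V^H`, `H = Stab(a)`. Hence `dim W ≤ dim V`. Each
`α⁻¹ a` is again a generator, so it equals `g a` for some `g`, and counting gives `|Aut F| · |H| ≤
|Aut M|`.

If the two group orders agree, then `H = 1`. Any `u` with `F(u) a = 0` and `1 + u` invertible is
then zero. This makes `p` an isomorphism, so `F` is represented by a summand `X` of `M` and its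
support is at most that of `M`. If the supports agree too, a non-zero complement of `X` would share
an indecomposable summand with `X`, and this would give a non-zero square-zero `u` killing `a`; so
`X ≅ M`.

The statements about presentations rest on a Fitting argument (`isIso_of_comp_eq`): an endomorphism
of a projective cover that lifts an epimorphism of `F` has an idempotent power, and minimality
forces that power to be the identity. -/

theorem exists_isIdempotentElem_pow {S : Type*} [Monoid S] [Finite S] (x : S) :
    ∃ n, 0 < n ∧ IsIdempotentElem (x ^ n) := by
  obtain ⟨i, j, hij, h⟩ : ∃ i j : ℕ, i < j ∧ x ^ i = x ^ j := by
    obtain ⟨i, j, hne, h⟩ := Finite.exists_ne_map_eq_of_infinite (fun k : ℕ => x ^ k)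
    rcases lt_or_gt_of_ne hne with hlt | hlt
    · exact ⟨i, j, hlt, h⟩
    · exact ⟨j, i, hlt, h.symm⟩
  obtain ⟨d, hd, rfl⟩ : ∃ d, 0 < d ∧ j = i + d := ⟨j - i, by omega, by omega⟩
  have step : ∀ k, i ≤ k → x ^ (k + d) = x ^ k := by
    intro k hk
    obtain ⟨c, rfl⟩ := Nat.exists_eq_add_of_le hk
    rw [show i + c + d = i + d + c by ring, pow_add, ← h, ← pow_add]
  have steps : ∀ c k, i ≤ k → x ^ (k + c * d) = x ^ k := by
    intro c
    induction c with
    | zero => simp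
    | succ c ih =>
      intro k hk
      rw [show k + (c + 1) * d = k + c * d + d by ring, step _ (by omega), ih k hk]
  -- The exponent is a multiple of the period `d` lying beyond the preperiod `i`, so doubling it
  -- does not change the power.
  refine ⟨(i + 1) * d, by positivity, ?_⟩
  change x ^ _ * x ^ _ = x ^ _
  rw [← pow_add, steps _ _ (by nlinarith)]

theorem isUnit_or_isNilpotent {S : Type*} [Ring S] [Finite S]
    (hS : ∀ e : S, IsIdempotentElem e → e = 0 ∨ e = 1) (x : S) : IsUnit x ∨ IsNilpotent x := by
  obtain ⟨n, hn, hx⟩ := exists_isIdempotentElem_pow x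
  rcases hS _ hx with h | h
  · exact Or.inr ⟨n, h⟩
  · exact Or.inl (IsUnit.of_pow_eq_one h hn.ne')

/-- A finite ring without non-trivial idempotents is local: after dividing by the sum, one term is
either a unit or nilpotent, and in the latter case the other term is 1 minus a nilpotent. -/
theorem isUnit_or_isUnit_of_add {S : Type*} [Ring S] [Finite S]
    (hS : ∀ e : S, IsIdempotentElem e → e = 0 ∨ e = 1) {x y : S} (h : IsUnit (x + y)) :
    IsUnit x ∨ IsUnit y := by
  obtain ⟨w, hw⟩ := h
  have h1 : (↑w⁻¹ : S) * x + ↑w⁻¹ * y = 1 := by rw [← mul_add, ← hw, Units.inv_mul]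
  rcases isUnit_or_isNilpotent hS ((↑w⁻¹ : S) * x) with h2 | h2
  · left
    exact (Units.isUnit_units_mul _ _).1 h2
  · right
    have : (↑w⁻¹ : S) * y = 1 - ↑w⁻¹ * x := by rw [← h1]; abel
    rw [← Units.isUnit_units_mul w⁻¹, this]
    exact h2.isUnit_one_sub

theorem exists_isUnit_of_isUnit_sum {S : Type*} [Ring S] [Finite S] [Nontrivial S]
    (hS : ∀ e : S, IsIdempotentElem e → e = 0 ∨ e = 1) {ι : Type*} (s : Finset ι) (f : ι → S)
    (h : IsUnit (∑ i ∈ s, f i)) : ∃ i ∈ s, IsUnit (f i) := by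
  classical
  induction s using Finset.induction_on with
  | empty => simp at h
  | insert i s hi ih =>
    rw [Finset.sum_insert hi] at h
    rcases isUnit_or_isUnit_of_add hS h with h | h
    · exact ⟨i, by simp, h⟩
    · obtain ⟨j, hj, h⟩ := ih h
      exact ⟨j, by simp [hj], h⟩

end FiniteRing

/-! ### Cancellation for finite modules. -/

section FiniteModule

variable {R : Type*} [Ring R]

instance finite_linearMap {X Y : Type*} [AddCommGroup X] [Module R X] [AddCommGroup Y] [Module R Y]
    [Finite X] [Finite Y] : Finite (X →ₗ[R] Y) :=
  DFunLike.finite _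

/-- The range and the kernel of a non-trivial idempotent. The drop in cardinality drives the
inductions below. -/
theorem exists_submodules_of_not_trivial_idempotents {X : Type*} [AddCommGroup X] [Module R X]
    [Finite X] (h : ¬ ∀ e : Module.End R X, IsIdempotentElem e → e = 0 ∨ e = 1) :
    ∃ P Q : Submodule R X, IsCompl P Q ∧ Nat.card P < Nat.card X ∧ Nat.card Q < Nat.card X := by
  push Not at h
  obtain ⟨e, he, h0, h1⟩ := h
  have hlt : ∀ P : Submodule R X, P ≠ ⊤ → Nat.card P < Nat.card X := by
    intro P hP
    refine lt_of_le_of_ne (Nat.card_le_card_of_injective _ P.injective_subtype) fun hc => hP ?_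
    rw [← Submodule.toAddSubgroup_inj]
    exact AddSubgroup.eq_top_of_card_eq _ hc
  have hc := LinearMap.IsIdempotentElem.isCompl he
  refine ⟨_, _, hc, hlt _ fun ht => h1 ?_, hlt _ fun ht => h0 ?_⟩
  · rw [ht] at hc
    have hk : LinearMap.ker e = ⊥ := by simpa using hc.inf_eq_bot
    ext x
    apply LinearMap.ker_eq_bot.1 hk
    exact LinearMap.congr_fun he x
  · exact LinearMap.ker_eq_top.1 ht

/-- If the component `X → X` of an isomorphism `X × A ≃ X × B` of finite modules is bijective, then
`A ≃ B`. -/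
theorem nonempty_equiv_of_isUnit_component {X A B : Type*} [AddCommGroup X] [Module R X] [Finite X]
    [AddCommGroup A] [Module R A] [Finite A] [AddCommGroup B] [Module R B] [Finite B]
    (φ : (X × A) ≃ₗ[R] (X × B))
    (h : IsUnit (LinearMap.fst R X B ∘ₗ φ.toLinearMap ∘ₗ LinearMap.inl R X A : Module.End R X)) :
    Nonempty (A ≃ₗ[R] B) := by
  obtain ⟨p, hp⟩ := h
  -- Gaussian elimination: the vectors `(-c a, a)` are those whose image under `φ` has zero
  -- `X`-component.
  let c : A →ₗ[R] X := (↑p⁻¹ : Module.End R X) ∘ₗ LinearMap.fst R X B ∘ₗ φ.toLinearMap ∘ₗ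
    LinearMap.inr R X A
  let f : A →ₗ[R] B := LinearMap.snd R X B ∘ₗ φ.toLinearMap ∘ₗ ((-c).prod LinearMap.id)
  have hcomp : ∀ a, (φ (-c a, a)).1 = 0 := by
    intro a
    have h1 : φ (-c a, a) = φ (-c a, 0) + φ (0, a) := by rw [← map_add]; simp
    have h2 : (φ (-c a, 0)).1 = (p : Module.End R X) (-c a) := by rw [hp]; rfl
    have h3 : (p : Module.End R X) (c a) = (φ (0, a)).1 := by
      change ((p : Module.End R X) * (↑p⁻¹ : Module.End R X)) _ = _
      rw [Units.mul_inv]; rfl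
    rw [h1, Prod.fst_add, h2, map_neg, h3, neg_add_cancel]
  have hf : Function.Injective f := by
    rw [← LinearMap.ker_eq_bot, LinearMap.ker_eq_bot']
    intro a ha
    have : φ (-c a, a) = 0 := Prod.ext (hcomp a) ha
    simpa using congrArg Prod.snd (φ.map_eq_zero_iff.1 this)
  have hcard : Nat.card A = Nat.card B := by
    have := Nat.card_congr φ.toEquiv
    rw [Nat.card_prod, Nat.card_prod] at this
    exact Nat.eq_of_mul_eq_mul_left Nat.card_pos this
  exact ⟨LinearEquiv.ofBijective f ((Nat.bijective_iff_injective_and_card f).2 ⟨hf, hcard⟩)⟩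

/-- The `X`-block of `φ φ⁻¹ = 1` reads `p p' + q r' = 1` in a local ring. If `p` is a unit,
elimination applies. Otherwise `q r'` is a unit, and shearing the source by `r'` replaces the block
`p` by `p + q r'`, which is a unit because `p` is not. -/
theorem cancel_of_trivial_idempotents {X A B : Type*} [AddCommGroup X] [Module R X] [Finite X]
    [AddCommGroup A] [Module R A] [Finite A] [AddCommGroup B] [Module R B] [Finite B]
    (hX : ∀ e : Module.End R X, IsIdempotentElem e → e = 0 ∨ e = 1)
    (φ : (X × A) ≃ₗ[R] (X × B)) : Nonempty (A ≃ₗ[R] B) := by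
  let p : Module.End R X := LinearMap.fst R X B ∘ₗ φ.toLinearMap ∘ₗ LinearMap.inl R X A
  let q : A →ₗ[R] X := LinearMap.fst R X B ∘ₗ φ.toLinearMap ∘ₗ LinearMap.inr R X A
  let p' : Module.End R X := LinearMap.fst R X A ∘ₗ φ.symm.toLinearMap ∘ₗ LinearMap.inl R X B
  let r' : X →ₗ[R] A := LinearMap.snd R X A ∘ₗ φ.symm.toLinearMap ∘ₗ LinearMap.inl R X B
  have hpq : p * p' + q ∘ₗ r' = 1 := by
    ext x
    change (φ ((φ.symm (x, 0)).1, 0)).1 + (φ (0, (φ.symm (x, 0)).2)).1 = x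
    rw [← Prod.fst_add, ← map_add]
    simp
  by_cases hp : IsUnit p
  · exact nonempty_equiv_of_isUnit_component φ hp
  have hqr : IsUnit (q ∘ₗ r' : Module.End R X) := by
    rcases isUnit_or_isUnit_of_add hX (hpq ▸ isUnit_one) with h | h
    · obtain ⟨u, hu⟩ := h
      refine (hp (IsUnit.of_mul_eq_one (p' * (↑u⁻¹ : Module.End R X)) ?_)).elim
      rw [← mul_assoc, ← hu, Units.mul_inv]
    · exact h
  refine nonempty_equiv_of_isUnit_component
    ((LinearEquiv.skewProd (LinearEquiv.refl R X) (LinearEquiv.refl R A) r').trans φ) ?_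
  have heq : LinearMap.fst R X B ∘ₗ ((LinearEquiv.skewProd (LinearEquiv.refl R X)
      (LinearEquiv.refl R A) r').trans φ).toLinearMap ∘ₗ LinearMap.inl R X A =
      p + q ∘ₗ r' := by
    ext x
    change (φ (x, 0 + r' x)).1 = (φ (x, 0)).1 + (φ (0, r' x)).1
    rw [← Prod.fst_add, ← map_add]
    simp
  rw [heq]
  have hqr' : IsUnit ((p + q ∘ₗ r') + -p) := by
    rwa [add_neg_cancel_comm]
  rcases isUnit_or_isUnit_of_add hX hqr' with h | h
  · exact h
  · exact (hp (by simpa using h)).elim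

/-- Finite modules may be cancelled from direct sums. -/
theorem nonempty_equiv_of_prod_equiv {X A B : Type v} [AddCommGroup X] [Module R X] [Finite X]
    [AddCommGroup A] [Module R A] [Finite A] [AddCommGroup B] [Module R B] [Finite B]
    (φ : (X × A) ≃ₗ[R] (X × B)) : Nonempty (A ≃ₗ[R] B) := by
  obtain ⟨k, hk⟩ : ∃ k, Nat.card X = k := ⟨_, rfl⟩
  induction k using Nat.strong_induction_on generalizing X A B with
  | _ k ih =>
    by_cases hX : ∀ e : Module.End R X, IsIdempotentElem e → e = 0 ∨ e = 1
    · exact cancel_of_trivial_idempotents hX φ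
    · obtain ⟨P, Q, hPQ, hP, hQ⟩ := exists_submodules_of_not_trivial_idempotents hX
      -- Cancel `P` first, with `Q` absorbed into both remaining factors, and then cancel `Q`.
      let e := Submodule.prodEquivOfIsCompl P Q hPQ
      obtain ⟨ψ⟩ := ih _ (hk ▸ hP) ((LinearEquiv.prodAssoc R P Q A).symm.trans
        ((e.prodCongr (LinearEquiv.refl R A)).trans
        (φ.trans ((e.symm.prodCongr (LinearEquiv.refl R B)).trans (LinearEquiv.prodAssoc R P Q B)))))
        rfl
      exact ih _ (hk ▸ hQ) ψ rfl

end FiniteModule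

/-! ### Closure properties of `𝒞` -/

section Sum

variable {R : Type u} [Ring R] {n : ℕ} {N : Fin n → ModuleCat.{v} R}

theorem IsSumOf.of_equiv {X Y : ModuleCat.{v} R} (e : X ≃ₗ[R] Y) (hX : IsSumOf N X) :
    IsSumOf N Y := by
  obtain ⟨b, ⟨f⟩⟩ := hX
  exact ⟨b, ⟨e.symm.trans f⟩⟩

theorem IsSumOf.of_subsingleton {X : ModuleCat.{v} R} [Subsingleton X] : IsSumOf N X := by
  refine ⟨fun _ => 0, ⟨?_⟩⟩
  exact LinearEquiv.ofSubsingleton _ _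

theorem isSumOf_of (k : Fin n) : IsSumOf N (N k) := by
  classical
  refine ⟨Pi.single k 1, ⟨LinearEquiv.symm ?_⟩⟩
  let f : ((i : Fin n) → (Fin ((Pi.single k 1 : Fin n → ℕ) i) → N i)) →ₗ[R] N k :=
    { toFun := fun x => x k ⟨0, by simp⟩
      map_add' := fun _ _ => rfl
      map_smul' := fun _ _ => rfl }
  refine LinearEquiv.ofBijective f ?_
  constructor
  · intro x y hxy
    funext i j
    by_cases hi : i = k
    · subst hi
      have hj : j = ⟨0, by simp⟩ := by
        ext
        have := j.2
        simp only [Pi.single_eq_same] at this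
        simpa using this
      rw [hj]
      exact hxy
    · have := j.2
      simp [Pi.single_eq_of_ne hi] at this
  · intro y
    refine ⟨Pi.single k (fun _ => y), ?_⟩
    change (Pi.single k (fun _ => y) : (i : Fin n) → (Fin _ → N i)) k _ = y
    rw [Pi.single_eq_same]

theorem IsSumOf.prod {X Y : ModuleCat.{v} R} (hX : IsSumOf N X) (hY : IsSumOf N Y) :
    IsSumOf N (ModuleCat.of R (X × Y)) := by
  obtain ⟨b, ⟨f⟩⟩ := hX
  obtain ⟨c, ⟨g⟩⟩ := hY
  let e : ((i : Fin n) → (Fin (b i + c i) → N i)) ≃ₗ[R]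
      ((i : Fin n) → (Fin (b i) → N i)) × ((i : Fin n) → (Fin (c i) → N i)) :=
    { toFun := fun x => (fun i j => x i (Fin.castAdd _ j), fun i j => x i (Fin.natAdd _ j))
      map_add' := fun _ _ => rfl
      map_smul' := fun _ _ => rfl
      invFun := fun y i => Fin.append (y.1 i) (y.2 i)
      left_inv := fun x => by
        funext i
        exact Fin.append_castAdd_natAdd
      right_inv := fun y => by
        ext i j <;> simp }
  exact ⟨fun i => b i + c i, ⟨(f.prodCongr g).trans e.symm⟩⟩

/-- The endomorphism rings of the modules `N i` have no non-trivial idempotents. -/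
abbrev HasTrivialIdempotents (N : Fin n → ModuleCat.{v} R) : Prop :=
  ∀ i, ∀ e : Module.End R (N i), IsIdempotentElem e → e = 0 ∨ e = 1

/-- The Krull–Schmidt argument. If `End X` is local, the identity of `X` is the sum of the
composites `X → N (t j) → X`, so one of them is a unit and `X` is a retract of that `N (t j)`; the
resulting idempotent of `N (t j)` is not 0 when `X` is non-zero, hence is 1. Otherwise `X` splits
into two smaller retracts. -/
theorem IsSumOf.of_retract_pi (hN : HasTrivialIdempotents N) {ι : Type*} [Fintype ι]
    (t : ι → Fin n) {X : ModuleCat.{v} R} [Finite X]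
    (f : X →ₗ[R] ((j : ι) → N (t j))) (g : ((j : ι) → N (t j)) →ₗ[R] X)
    (h : g ∘ₗ f = LinearMap.id) : IsSumOf N X := by
  classical
  obtain ⟨k, hk⟩ : ∃ k, Nat.card X = k := ⟨_, rfl⟩
  induction k using Nat.strong_induction_on generalizing X with
  | _ k ih =>
    by_cases hX : ∀ e : Module.End R X, IsIdempotentElem e → e = 0 ∨ e = 1
    · rcases subsingleton_or_nontrivial X with hs | hs
      · exact IsSumOf.of_subsingleton
      have hsum : ∑ j, (g ∘ₗ LinearMap.single R (fun j => N (t j)) j ∘ₗ LinearMap.proj j ∘ₗ f :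
          Module.End R X) = 1 := by
        ext x
        simp only [LinearMap.sum_apply, LinearMap.comp_apply, ← map_sum]
        have := LinearMap.congr_fun h x
        rw [LinearMap.comp_apply] at this
        refine Eq.trans (congrArg g ?_) this
        exact Finset.univ_sum_single (f x)
      obtain ⟨j, -, u, hu⟩ := exists_isUnit_of_isUnit_sum hX _ _ (hsum ▸ isUnit_one)
      let a : X →ₗ[R] N (t j) := LinearMap.proj j ∘ₗ f
      let b : N (t j) →ₗ[R] X := (↑u⁻¹ : Module.End R X) ∘ₗ g ∘ₗ
        LinearMap.single R (fun j => N (t j)) j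
      have hba : b ∘ₗ a = LinearMap.id := by
        have h1 := u.inv_mul
        rw [hu] at h1
        exact h1
      have hba' : ∀ x, b (a x) = x := fun x => LinearMap.congr_fun hba x
      have hab : a ∘ₗ b = LinearMap.id := by
        rcases hN (t j) (a ∘ₗ b) (LinearMap.ext fun y => congrArg a (hba' (b y))) with h0 | h1
        · obtain ⟨x, hx⟩ := exists_ne (0 : X)
          refine (hx ?_).elim
          have h2 : a x = 0 := by
            have := LinearMap.congr_fun h0 (a x)
            rwa [LinearMap.comp_apply, hba'] at this
          rw [← hba' x, h2, map_zero]
        · exact h1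
      exact (isSumOf_of (t j)).of_equiv (LinearEquiv.ofLinearMap b a hba hab)
    · obtain ⟨P, Q, hPQ, hP, hQ⟩ := exists_submodules_of_not_trivial_idempotents hX
      let e := Submodule.prodEquivOfIsCompl P Q hPQ
      have hP' : IsSumOf N (ModuleCat.of R P) := by
        refine ih _ (hk ▸ hP) (f ∘ₗ P.subtype)
          ((LinearMap.fst R P Q ∘ₗ e.symm.toLinearMap) ∘ₗ g) ?_ rfl
        ext x
        have := LinearMap.congr_fun h (x : X)
        simp only [LinearMap.comp_apply, LinearMap.id_apply, Submodule.subtype_apply] at this ⊢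
        rw [this]
        simp [e]
      have hQ' : IsSumOf N (ModuleCat.of R Q) := by
        refine ih _ (hk ▸ hQ) (f ∘ₗ Q.subtype)
          ((LinearMap.snd R P Q ∘ₗ e.symm.toLinearMap) ∘ₗ g) ?_ rfl
        ext x
        have := LinearMap.congr_fun h (x : X)
        simp only [LinearMap.comp_apply, LinearMap.id_apply, Submodule.subtype_apply] at this ⊢
        rw [this]
        simp [e]
      exact (hP'.prod hQ').of_equiv e

/-- Retracts of objects of `𝒞` are in `𝒞`. -/
theorem IsSumOf.of_retract (hN : HasTrivialIdempotents N) {X Y : ModuleCat.{v} R} [Finite X]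
    (hY : IsSumOf N Y) (r : Retract X Y) : IsSumOf N X := by
  obtain ⟨b, ⟨e⟩⟩ := hY
  let e' : ((i : Fin n) → (Fin (b i) → N i)) ≃ₗ[R] ((j : (i : Fin n) × Fin (b i)) → N j.1) :=
    { toFun := fun x j => x j.1 j.2
      map_add' := fun _ _ => rfl
      map_smul' := fun _ _ => rfl
      invFun := fun y i j => y ⟨i, j⟩
      left_inv := fun _ => rfl
      right_inv := fun _ => rfl }
  refine IsSumOf.of_retract_pi hN (fun j : (i : Fin n) × Fin (b i) => j.1)
    ((e.trans e').toLinearMap ∘ₗ r.i.hom) (r.r.hom ∘ₗ (e.trans e').symm.toLinearMap) ?_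
  ext x
  have h : r.r.hom (r.i.hom x) = x := congrArg (fun f => f x) (congrArg ModuleCat.Hom.hom r.retract)
  simpa using h

end Sum

/-! ### Retracts and idempotents in abelian categories -/

section Abelian

variable {C : Type*} [Category C] [Abelian C]

theorem exists_retract_of_idempotent {X : C} {e : X ⟶ X} (he : e ≫ e = e) :
    ∃ (Y : C) (s : Retract Y X), s.r ≫ s.i = e := by
  obtain ⟨Y, i, r, h1, h2⟩ := IsIdempotentComplete.idempotents_split X e he
  exact ⟨Y, ⟨i, r, h1⟩, h2⟩

theorem Retract.exists_complement {X Y : C} (s : Retract Y X) :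
    ∃ (Z : C) (t : Retract Z X), s.r ≫ s.i + t.r ≫ t.i = 𝟙 X ∧ Nonempty (X ≅ Y ⊞ Z) := by
  obtain ⟨Z, t, ht⟩ := exists_retract_of_idempotent (X := X) (e := 𝟙 X - s.r ≫ s.i) (by simp)
  have h1 : s.i ≫ t.r = 0 := by
    rw [← cancel_mono t.i, Category.assoc, ht]
    simp
  have h2 : t.i ≫ s.r = 0 := by
    rw [← cancel_epi t.r, ← Category.assoc, ht]
    simp
  let b : BinaryBicone Y Z :=
    { pt := X, fst := s.r, snd := t.r, inl := s.i, inr := t.i, inl_fst := s.retract,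
      inl_snd := h1, inr_fst := h2, inr_snd := t.retract }
  have ht' : s.r ≫ s.i + t.r ≫ t.i = 𝟙 X := by rw [ht]; abel
  exact ⟨Z, t, ht', ⟨biprod.uniqueUpToIso Y Z (isBinaryBilimitOfTotal b ht')⟩⟩

theorem isDirectSummand_iff {X Y : C} : IsDirectSummand Y X ↔ Nonempty (Retract Y X) := by
  constructor
  · rintro ⟨Z, ⟨e⟩⟩
    exact ⟨⟨biprod.inl ≫ e.inv, e.hom ≫ biprod.fst, by simp⟩⟩
  · rintro ⟨s⟩
    obtain ⟨Z, -, -, h⟩ := Retract.exists_complement s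
    exact ⟨Z, h⟩

theorem indecomposable_iff {X : C} :
    Indecomposable X ↔ ¬ IsZero X ∧ ∀ e : X ⟶ X, e ≫ e = e → e = 0 ∨ e = 𝟙 X := by
  refine and_congr_right fun _ => ⟨fun h e he => ?_, fun h Y Z φ => ?_⟩
  · obtain ⟨Y, s, hs⟩ := exists_retract_of_idempotent he
    obtain ⟨Z, t, ht, ⟨φ⟩⟩ := Retract.exists_complement s
    rcases h Y Z φ with h | h
    · left
      rw [← hs, h.eq_of_tgt s.r 0, zero_comp]
    · right
      rw [h.eq_of_tgt t.r 0, zero_comp, add_zero] at ht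
      rw [← hs, ht]
  -- The projection onto `Y` is an idempotent `e`. If `e = 0`, the identity of `Y` vanishes by `h1`;
  -- if `e = 1`, the identity of `Z` vanishes by `h2`.
  · have h1 : biprod.inl ≫ φ.inv ≫ (φ.hom ≫ biprod.fst ≫ biprod.inl ≫ φ.inv) ≫ φ.hom ≫
        biprod.fst = 𝟙 Y := by simp
    have h2 : biprod.inr ≫ φ.inv ≫ (φ.hom ≫ biprod.fst ≫ biprod.inl ≫ φ.inv) ≫ φ.hom ≫
        biprod.snd = (0 : Z ⟶ Z) := by simp
    rcases h (φ.hom ≫ biprod.fst ≫ biprod.inl ≫ φ.inv) (by simp) with h | h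
    · left
      rw [h] at h1
      rw [IsZero.iff_id_eq_zero, ← h1]
      simp
    · right
      rw [h] at h2
      rw [IsZero.iff_id_eq_zero, ← h2]
      simp

/-- Some power of `x` is idempotent and lifts a power of `φ`, which is still an epimorphism. The
summand of `P` that it splits off therefore maps onto `F`. Minimality of the cover makes this
summand all of `P`, so the power is the identity. -/
theorem isIso_of_comp_eq {P F : C} [Finite (P ⟶ P)] {p : P ⟶ F}
    (hp : Epi p) (hcov : ∀ (Q : C) (s : Retract Q P), Epi (s.i ≫ p) → IsIso s.i)
    {x : P ⟶ P} {φ : F ⟶ F} [Epi φ] (h : x ≫ p = p ≫ φ) : IsIso x := by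
  have : Finite (End P) := ‹Finite (P ⟶ P)›
  obtain ⟨n, hn, hx⟩ := exists_isIdempotentElem_pow (End.of x)
  have hpow : ∀ k : ℕ, ∃ ψ : F ⟶ F, Epi ψ ∧ ((End.of x) ^ k : P ⟶ P) ≫ p = p ≫ ψ := by
    intro k
    induction k with
    | zero => exact ⟨𝟙 F, inferInstance, by
        rw [pow_zero]
        exact (Category.id_comp p).trans (Category.comp_id p).symm⟩
    | succ k ih =>
      obtain ⟨ψ, hψ, hk⟩ := ih
      refine ⟨φ ≫ ψ, epi_comp _ _, ?_⟩
      have h1 : (((End.of x) ^ (k + 1) : End P) : P ⟶ P) = x ≫ ((End.of x) ^ k : End P) := by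
        rw [pow_succ]; rfl
      rw [h1, Category.assoc, hk, reassoc_of% h]
  obtain ⟨ψ, hψ, hk⟩ := hpow n
  obtain ⟨Q, s, hs⟩ := exists_retract_of_idempotent (X := P) (e := ((End.of x) ^ n : End P)) hx
  have hepi : Epi (s.i ≫ p) := by
    have : Epi (s.r ≫ s.i ≫ p) := by
      rw [← Category.assoc, hs, hk]
      exact epi_comp _ _
    exact epi_of_epi s.r _
  have := hcov Q s hepi
  have hone : s.r ≫ s.i = 𝟙 P := by
    rw [← cancel_epi s.i]
    simp
  have hu : IsUnit (End.of x) := IsUnit.of_pow_eq_one (hs.symm.trans hone) hn.ne'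
  exact (isUnit_iff_isIso _).1 hu

end Abelian

/-! ### Functors on `𝒞` and their points -/

section Functors

set_option linter.unusedSectionVars false

variable {A : Type w} [CommRing A] {R : Type u} [Ring R] [Algebra A R] {n : ℕ}
variable {N : Fin n → ModuleCat.{v} R}

theorem epi_iff_app_surjective {F G : SumCat N ⥤ ModuleCat.{v} A} (p : F ⟶ G) :
    Epi p ↔ ∀ X, Function.Surjective (p.app X) := by
  rw [NatTrans.epi_iff_epi_app]
  exact forall_congr' fun X => ModuleCat.epi_iff_surjective _

theorem mono_iff_app_injective {F G : SumCat N ⥤ ModuleCat.{v} A} (p : F ⟶ G) :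
    Mono p ↔ ∀ X, Function.Injective (p.app X) := by
  rw [NatTrans.mono_iff_mono_app]
  exact forall_congr' fun X => ModuleCat.mono_iff_injective _

theorem app_map {F G : SumCat N ⥤ ModuleCat.{v} A} (p : F ⟶ G) {X Y : SumCat N} (f : X ⟶ Y)
    (x : F.obj X) : p.app Y (F.map f x) = G.map f (p.app X x) := by
  simp only [← ConcreteCategory.comp_apply, NatTrans.naturality]

theorem IsLinearFunctor.map_add {F : SumCat N ⥤ ModuleCat.{v} A} (hF : IsLinearFunctor F)
    {X Y : SumCat N} (f g : X ⟶ Y) (x : F.obj X) : F.map (f + g) x = F.map f x + F.map g x := by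
  have := hF.additive
  rw [Functor.map_add]
  rfl

theorem IsLinearFunctor.map_zero {F : SumCat N ⥤ ModuleCat.{v} A} (hF : IsLinearFunctor F)
    {X Y : SumCat N} (x : F.obj X) : F.map (0 : X ⟶ Y) x = 0 := by
  have := hF.additive
  rw [Functor.map_zero]
  rfl

theorem IsLinearFunctor.map_smul {F : SumCat N ⥤ ModuleCat.{v} A} (hF : IsLinearFunctor F)
    {X Y : SumCat N} (c : A) (f : X ⟶ Y) (x : F.obj X) : F.map (c • f) x = c • F.map f x := by
  have := hF.additive
  have := hF.linear
  rw [Functor.map_smul]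
  rfl

theorem IsLinearFunctor.map_sum {F : SumCat N ⥤ ModuleCat.{v} A} (hF : IsLinearFunctor F)
    {X Y : SumCat N} {ι : Type*} (s : Finset ι) (f : ι → (X ⟶ Y)) (x : F.obj X) :
    F.map (∑ i ∈ s, f i) x = ∑ i ∈ s, F.map (f i) x := by
  classical
  induction s using Finset.induction_on with
  | empty => simpa using hF.map_zero x
  | insert i s hi ih => rw [Finset.sum_insert hi, Finset.sum_insert hi, hF.map_add, ih]

theorem map_map {F : SumCat N ⥤ ModuleCat.{v} A} {X Y Z : SumCat N} (f : X ⟶ Y) (g : Y ⟶ Z)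
    (x : F.obj X) : F.map g (F.map f x) = F.map (f ≫ g) x := by
  rw [Functor.map_comp, ConcreteCategory.comp_apply]

/-- The morphism `Hom(X, -) ⟶ F` corresponding to a point of `F(X)` by the Yoneda lemma. -/
noncomputable def pointMap {F : SumCat N ⥤ ModuleCat.{v} A} (hF : IsLinearFunctor F) {X : SumCat N}
    (a : F.obj X) : homFun A X ⟶ F where
  app Z := ModuleCat.ofHom (X := X ⟶ Z)
    { toFun := fun f => F.map f a
      map_add' := fun f g => hF.map_add f g a
      map_smul' := fun c f => hF.map_smul c f a }
  naturality Y Z g := by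
    ext f
    exact (map_map f g a).symm

theorem pointMap_app {F : SumCat N ⥤ ModuleCat.{v} A} (hF : IsLinearFunctor F) {X Z : SumCat N}
    (a : F.obj X) (f : X ⟶ Z) : (pointMap hF a).app Z f = F.map f a := rfl

/-- The point of `F(X)` corresponding to a morphism `Hom(X, -) ⟶ F`. -/
def pt {F : SumCat N ⥤ ModuleCat.{v} A} {X : SumCat N} (p : homFun A X ⟶ F) : F.obj X :=
  p.app X (𝟙 X)

theorem app_eq {F : SumCat N ⥤ ModuleCat.{v} A} {X Z : SumCat N} (p : homFun A X ⟶ F) (f : X ⟶ Z) :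
    p.app Z f = F.map f (pt p) := by
  refine Eq.trans ?_ (app_map p f (𝟙 X : X ⟶ X))
  exact congrArg (p.app Z) (Category.id_comp f).symm

theorem pt_injective {F : SumCat N ⥤ ModuleCat.{v} A} {X : SumCat N} {p q : homFun A X ⟶ F}
    (h : pt p = pt q) : p = q := by
  ext Z f
  exact (app_eq p f).trans ((congrArg _ h).trans (app_eq q f).symm)

@[simp] theorem pt_pointMap {F : SumCat N ⥤ ModuleCat.{v} A} (hF : IsLinearFunctor F) {X : SumCat N}
    (a : F.obj X) : pt (pointMap hF a) = a := by
  rw [pt, pointMap_app]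
  simp

theorem pt_homFunMap_comp {F : SumCat N ⥤ ModuleCat.{v} A} {X Y : SumCat N} (p : homFun A X ⟶ F)
    (f : X ⟶ Y) : pt (homFunMap A f ≫ p) = F.map f (pt p) := by
  rw [← app_eq]
  change p.app Y (f ≫ 𝟙 Y) = _
  rw [Category.comp_id]

theorem pt_comp {F G : SumCat N ⥤ ModuleCat.{v} A} {X : SumCat N} (p : homFun A X ⟶ F)
    (φ : F ⟶ G) : pt (p ≫ φ) = φ.app X (pt p) := rfl

theorem homFunMap_comp {X Y Z : SumCat N} (f : X ⟶ Y) (g : Y ⟶ Z) :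
    homFunMap A (f ≫ g) = homFunMap A g ≫ homFunMap A f := by
  rw [homFunMap, op_comp, Functor.map_comp]

theorem homFunMap_id (X : SumCat N) : homFunMap A (𝟙 X) = 𝟙 (homFun A X) := by
  rw [homFunMap, op_id, CategoryTheory.Functor.map_id]

theorem homFunMap_injective {X Y : SumCat N} {f g : X ⟶ Y} (h : homFunMap A f = homFunMap A g) :
    f = g :=
  Quiver.Hom.op_inj ((linearCoyoneda A (SumCat N)).map_injective h)

theorem homFunMap_surjective {X Y : SumCat N} (φ : homFun A Y ⟶ homFun A X) :
    ∃ f : X ⟶ Y, homFunMap A f = φ := by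
  obtain ⟨f, hf⟩ := (linearCoyoneda A (SumCat N)).map_surjective φ
  exact ⟨f.unop, hf⟩

theorem isIso_of_isIso_homFunMap {X Y : SumCat N} {f : X ⟶ Y} (h : IsIso (homFunMap A f)) :
    IsIso f := by
  have := isIso_of_reflects_iso f.op (linearCoyoneda A (SumCat N))
  exact (isIso_op_iff f).1 this

theorem IsLinearFunctor.of_mono {F G : SumCat N ⥤ ModuleCat.{v} A} (hF : IsLinearFunctor F)
    (i : G ⟶ F) [Mono i] : IsLinearFunctor G := by
  have hi := (mono_iff_app_injective i).1 inferInstance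
  refine ⟨⟨?_⟩, ⟨?_⟩, fun X => ?_⟩
  · intro X Y f g
    ext x
    apply hi
    change i.app Y (G.map (f + g) x) = i.app Y (G.map f x + G.map g x)
    rw [_root_.map_add, app_map, app_map, app_map, hF.map_add]
  · intro X Y f c
    ext x
    apply hi
    change i.app Y (G.map (c • f) x) = i.app Y (c • G.map f x)
    rw [LinearMap.map_smul_of_tower, app_map, app_map, hF.map_smul]
  · have := hF.finite X
    exact Finite.of_injective _ (hi X)

end Functors

/-! ### The category `𝒞` -/

section SumCat

variable {R : Type u} [Ring R] {n : ℕ} {N : Fin n → ModuleCat.{v} R}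

theorem finite_obj (hfin : ∀ i, Finite (N i)) (X : SumCat N) : Finite X.obj := by
  obtain ⟨b, ⟨e⟩⟩ := X.property
  exact Finite.of_equiv _ e.symm.toEquiv

theorem finite_hom (hfin : ∀ i, Finite (N i)) (X Y : SumCat N) : Finite (X ⟶ Y) := by
  have := finite_obj hfin X
  have := finite_obj hfin Y
  refine Finite.of_injective (fun f : X ⟶ Y => f.hom.hom) fun f g h => ?_
  ext1
  exact ModuleCat.hom_ext h

theorem finite_aut (hfin : ∀ i, Finite (N i)) (X : SumCat N) : Finite (Aut X) := by
  have := finite_hom hfin X X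
  exact Finite.of_injective (fun g : Aut X => (toIso g).hom) fun g h hgh => Iso.ext hgh

/-- The morphism of `𝒞` given by a linear map. -/
abbrev homOf {X Y : SumCat N} (f : X.obj →ₗ[R] Y.obj) : X ⟶ Y :=
  ObjectProperty.homMk (ModuleCat.ofHom f)

theorem hom_ext_apply {X Y : SumCat N} {f g : X ⟶ Y} (h : ∀ x, f.hom.hom x = g.hom.hom x) :
    f = g := by
  ext x
  exact h x

theorem sum_hom_apply {X Y : SumCat N} {ι : Type*} (s : Finset ι) (f : ι → (X ⟶ Y)) (x : X.obj) :
    (∑ i ∈ s, f i).hom.hom x = ∑ i ∈ s, (f i).hom.hom x := by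
  classical
  induction s using Finset.induction_on with
  | empty => rfl
  | insert i s hi ih =>
    rw [Finset.sum_insert hi, Finset.sum_insert hi, ← ih]
    rfl

/-- The splitting exists among `R`-modules, and `𝒞` is closed under retracts by the Krull–Schmidt
argument. -/
theorem exists_retract_of_idempotent_sumCat (hT : HasTrivialIdempotents N)
    (hfin : ∀ i, Finite (N i)) {X : SumCat N} {e : X ⟶ X} (he : e ≫ e = e) :
    ∃ (Y : SumCat N) (s : Retract Y X), s.r ≫ s.i = e := by
  have he' : e.hom ≫ e.hom = e.hom := congrArg (fun f => f.hom) he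
  obtain ⟨Y, s, hs⟩ := exists_retract_of_idempotent he'
  have := finite_obj hfin X
  have hY : Finite Y := by
    refine Finite.of_injective (fun y => s.i.hom y) ?_
    have : Mono s.i := inferInstance
    exact (ModuleCat.mono_iff_injective _).1 this
  refine ⟨⟨Y, X.property.of_retract hT s⟩, ⟨ObjectProperty.homMk s.i, ObjectProperty.homMk s.r, ?_⟩, ?_⟩
  · ext1; exact s.retract
  · ext1; exact hs

/-- Direct sums in `𝒞`. -/
theorem exists_sum (X Y : SumCat N) : ∃ (Z : SumCat N) (i : X ⟶ Z) (j : Y ⟶ Z) (r : Z ⟶ X)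
    (s : Z ⟶ Y), i ≫ r = 𝟙 X ∧ j ≫ s = 𝟙 Y ∧ i ≫ s = 0 ∧ j ≫ r = 0 := by
  refine ⟨⟨_, X.property.prod Y.property⟩, homOf (LinearMap.inl R X.obj Y.obj),
    homOf (LinearMap.inr R X.obj Y.obj), homOf (LinearMap.fst R X.obj Y.obj),
    homOf (LinearMap.snd R X.obj Y.obj), ?_, ?_, ?_, ?_⟩ <;> rfl

/-- An object `M` in which every `N i` occurs generates `𝒞`. -/
def Generates (M : SumCat N) : Prop :=
  ∀ Z : SumCat N, ∃ (k : ℕ) (a : Fin k → (Z ⟶ M)) (b : Fin k → (M ⟶ Z)), ∑ j, a j ≫ b j = 𝟙 Z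

/-- Each summand `N i` of `Z` is routed through the first copy of `N i` in `M`, which exists because
`0 < m i`. -/
theorem generates_of_equiv {M : SumCat N} {m : Fin n → ℕ} (hm : ∀ i, 0 < m i)
    (e : M.obj ≃ₗ[R] ((i : Fin n) → (Fin (m i) → N i))) : Generates M := by
  classical
  intro Z
  obtain ⟨b, ⟨f⟩⟩ := Z.property
  let ι := (i : Fin n) × Fin (b i)
  let inN : (j : ι) → Z.obj →ₗ[R] N j.1 := fun j =>
    LinearMap.proj (R := R) (φ := fun _ : Fin (b j.1) => N j.1) j.2 ∘ₗ
      LinearMap.proj (R := R) (φ := fun i => Fin (b i) → N i) j.1 ∘ₗ f.toLinearMap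
  let outN : (j : ι) → N j.1 →ₗ[R] Z.obj := fun j =>
    f.symm.toLinearMap ∘ₗ LinearMap.single R (fun i => Fin (b i) → N i) j.1 ∘ₗ
      LinearMap.single R (fun _ : Fin (b j.1) => N j.1) j.2
  let inM : (i : Fin n) → N i →ₗ[R] M.obj := fun i =>
    e.symm.toLinearMap ∘ₗ LinearMap.single R (fun i => Fin (m i) → N i) i ∘ₗ
      LinearMap.single R (fun _ : Fin (m i) => N i) ⟨0, hm i⟩
  let outM : (i : Fin n) → M.obj →ₗ[R] N i := fun i =>
    LinearMap.proj (R := R) (φ := fun _ : Fin (m i) => N i) ⟨0, hm i⟩ ∘ₗ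
      LinearMap.proj (R := R) (φ := fun i => Fin (m i) → N i) i ∘ₗ e.toLinearMap
  have hM : ∀ i x, outM i (inM i x) = x := by
    intro i x
    simp [outM, inM]
  have hsum : ∑ j : ι, (homOf (inM j.1 ∘ₗ inN j) ≫ homOf (outN j ∘ₗ outM j.1) : Z ⟶ Z) = 𝟙 Z := by
    apply hom_ext_apply
    intro z
    rw [sum_hom_apply]
    change ∑ j : ι, outN j (outM j.1 (inM j.1 (inN j z))) = z
    simp only [hM]
    apply f.injective
    rw [map_sum]
    funext i l
    rw [Finset.sum_apply, Finset.sum_apply, Finset.sum_eq_single (⟨i, l⟩ : ι)]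
    · simp [outN, inN]
    · rintro ⟨i', l'⟩ - hne
      by_cases hi : i' = i
      · subst hi
        have hl : l ≠ l' := fun h => hne (by rw [h])
        simp [outN, inN, hl]
      · simp [outN, inN, Pi.single_eq_of_ne (Ne.symm hi)]
    · simp
  obtain ⟨k, ⟨g⟩⟩ := Finite.exists_equiv_fin ι
  refine ⟨k, fun j => homOf (inM (g.symm j).1 ∘ₗ inN (g.symm j)),
    fun j => homOf (outN (g.symm j) ∘ₗ outM (g.symm j).1), ?_⟩
  rw [← hsum]
  exact Equiv.sum_comp g.symm (fun j : ι =>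
    (homOf (inM j.1 ∘ₗ inN j) ≫ homOf (outN j ∘ₗ outM j.1) : Z ⟶ Z))

end SumCat

/-! ### Projective covers -/

section Covers

set_option linter.unusedSectionVars false

variable {A : Type w} [CommRing A] {R : Type u} [Ring R] [Algebra A R] {n : ℕ}
variable {N : Fin n → ModuleCat.{v} R}

theorem isLinearFunctor_homFun (hfin : ∀ i, Finite (N i)) (X : SumCat N) :
    IsLinearFunctor (homFun A X) where
  additive := inferInstance
  linear := ⟨fun f r => by
    ext g
    exact Linear.comp_smul _ _ _ g r f⟩
  finite Z := finite_hom hfin X Z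

theorem finite_homFun_end (hfin : ∀ i, Finite (N i)) (X : SumCat N) :
    Finite (homFun A X ⟶ homFun A X) := by
  have := finite_hom hfin X X
  exact Finite.of_surjective _ (homFunMap_surjective (A := A) (X := X) (Y := X))

/-- A linear functor is determined by its value at a generator `M`: every `z` is the sum of the `G(b
j)(G(a j) z)`, with `G(a j) z` in `G(M)`. -/
theorem epi_of_surjective_app {M : SumCat N} (hM : Generates M)
    {F G : SumCat N ⥤ ModuleCat.{v} A} (hG : IsLinearFunctor G) (p : F ⟶ G)
    (h : Function.Surjective (p.app M)) : Epi p := by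
  rw [epi_iff_app_surjective]
  intro Z z
  obtain ⟨k, a, b, hab⟩ := hM Z
  choose t ht using fun j => h (G.map (a j) z)
  refine ⟨∑ j, F.map (b j) (t j), ?_⟩
  rw [map_sum]
  simp only [app_map, ht, map_map]
  rw [← hG.map_sum, hab]
  simp

theorem mono_of_injective_app {M : SumCat N} (hM : Generates M)
    {F G : SumCat N ⥤ ModuleCat.{v} A} (hF : IsLinearFunctor F) (p : F ⟶ G)
    (h : ∀ x, p.app M x = 0 → x = 0) : Mono p := by
  rw [mono_iff_app_injective]
  intro Z
  rw [injective_iff_map_eq_zero]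
  intro z hz
  obtain ⟨k, a, b, hab⟩ := hM Z
  have h1 : ∀ j, F.map (a j) z = 0 := fun j => h _ (by rw [app_map, hz, map_zero])
  have h2 : z = F.map (∑ j, a j ≫ b j) z := by rw [hab]; simp
  rw [h2, hF.map_sum]
  refine Finset.sum_eq_zero fun j _ => ?_
  rw [← map_map, h1, map_zero]

/-- Since `F(M)` is finite, all its elements can be made the components of a single point of `F` at
a sum of copies of `M`. The Yoneda map of this point is onto at `M`, hence everywhere. -/
theorem exists_epi {M : SumCat N} (hM : Generates M) {F : SumCat N ⥤ ModuleCat.{v} A}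
    (hF : IsLinearFunctor F) : ∃ (X : SumCat N) (p : homFun A X ⟶ F), Epi p := by
  classical
  have key : ∀ s : Finset (F.obj M), ∃ (X : SumCat N) (x : F.obj X),
      ∀ z ∈ s, ∃ f : X ⟶ M, F.map f x = z := by
    intro s
    induction s using Finset.induction_on with
    | empty => exact ⟨M, 0, by simp⟩
    | insert z s hz ih =>
      obtain ⟨X, x, hx⟩ := ih
      obtain ⟨Z, i, j, r, t, h1, h2, h3, h4⟩ := exists_sum X M
      have hr : F.map r (F.map i x + F.map j z) = x := by
        rw [map_add, map_map, map_map, h1, h4, hF.map_zero]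
        simp
      have ht : F.map t (F.map i x + F.map j z) = z := by
        rw [map_add, map_map, map_map, h2, h3, hF.map_zero]
        simp
      refine ⟨Z, F.map i x + F.map j z, fun y hy => ?_⟩
      rcases Finset.mem_insert.1 hy with rfl | hy
      · exact ⟨t, ht⟩
      · obtain ⟨f, hf⟩ := hx y hy
        exact ⟨r ≫ f, by rw [← map_map, hr, hf]⟩
  have := hF.finite M
  have := Fintype.ofFinite (F.obj M)
  obtain ⟨X, x, hx⟩ := key Finset.univ
  refine ⟨X, pointMap hF x, epi_of_surjective_app hM hF _ fun z => ?_⟩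
  obtain ⟨f, hf⟩ := hx z (Finset.mem_univ z)
  exact ⟨f, hf⟩

theorem isIso_of_isIso_comp_retract {C : Type*} [Category C] {X Y : C} (s : Retract Y X)
    (h : s.r ≫ s.i = 𝟙 X) : IsIso s.i :=
  ⟨s.r, s.retract, h⟩

/-- Among the epimorphisms `Hom(X, -) ⟶ F`, one with `X` of least cardinality is a cover. A summand
of `Hom(X, -)` that still maps onto `F` comes from an idempotent of `X`; its image `Y` also covers
`F`, so `Y` is not smaller than `X` and the idempotent is 1. -/
theorem exists_cover (hT : HasTrivialIdempotents N) (hfin : ∀ i, Finite (N i)) {M : SumCat N}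
    (hM : Generates M) {F : SumCat N ⥤ ModuleCat.{v} A} (hF : IsLinearFunctor F) :
    ∃ (X : SumCat N) (p : homFun A X ⟶ F), IsCover p := by
  classical
  have hex : ∃ k, ∃ (X : SumCat N) (p : homFun A X ⟶ F), Epi p ∧ Nat.card X.obj = k := by
    obtain ⟨X, p, hp⟩ := exists_epi hM hF
    exact ⟨_, X, p, hp, rfl⟩
  obtain ⟨X, p, hp, hk⟩ := Nat.find_spec hex
  refine ⟨X, p, hp, fun Q s hs => ?_⟩
  obtain ⟨e, he⟩ := homFunMap_surjective (s.r ≫ s.i)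
  have hee : e ≫ e = e := by
    apply homFunMap_injective (A := A)
    rw [homFunMap_comp, he]
    simp
  obtain ⟨Y, t, ht⟩ := exists_retract_of_idempotent_sumCat hT hfin hee
  have hepi : Epi (homFunMap A t.r ≫ p) := by
    have h1 : homFunMap A t.i ≫ homFunMap A t.r ≫ p = s.r ≫ s.i ≫ p := by
      rw [← Category.assoc, ← homFunMap_comp, ht, he, Category.assoc]
    have h2 : Epi (s.r ≫ s.i ≫ p) := epi_comp _ _
    rw [← h1] at h2
    exact epi_of_epi (homFunMap A t.i) _
  have hle := Nat.find_min' hex ⟨Y, _, hepi, rfl⟩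
  rw [← hk] at hle
  have := finite_obj hfin X
  have := finite_obj hfin Y
  have hsurj : Function.Surjective t.r.hom.hom := fun y =>
    ⟨t.i.hom.hom y, congrArg (fun f => f.hom.hom y) t.retract⟩
  have hcard : Nat.card X.obj = Nat.card Y.obj :=
    le_antisymm hle (Nat.card_le_card_of_surjective _ hsurj)
  have hinj : Function.Injective t.r.hom.hom :=
    ((Nat.bijective_iff_surjective_and_card _).2 ⟨hsurj, hcard⟩).1
  have hone : e = 𝟙 X := by
    rw [← ht]
    apply hom_ext_apply
    intro x
    apply hinj
    exact congrArg (fun f => f.hom.hom (t.r.hom.hom x)) t.retract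
  apply isIso_of_isIso_comp_retract
  rw [← he, hone, homFunMap_id]

theorem exists_isMinimalPresentation (hT : HasTrivialIdempotents N) (hfin : ∀ i, Finite (N i))
    {M : SumCat N} (hM : Generates M) {F : SumCat N ⥤ ModuleCat.{v} A} (hF : IsLinearFunctor F) :
    ∃ (X Y : SumCat N) (f : X ⟶ Y) (p : homFun A X ⟶ F), IsMinimalPresentation f p := by
  obtain ⟨X, p, hp⟩ := exists_cover hT hfin hM hF
  obtain ⟨Y, q, hq⟩ := exists_cover hT hfin hM
    ((isLinearFunctor_homFun hfin X).of_mono (kernel.ι p))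
  obtain ⟨f, hf⟩ := homFunMap_surjective (q ≫ kernel.ι p)
  have h0 : homFunMap A f ≫ p = 0 := by rw [hf, Category.assoc, kernel.condition, comp_zero]
  refine ⟨X, Y, f, p, hp, h0, ?_⟩
  have : kernel.lift p (homFunMap A f) h0 = q := by
    rw [← cancel_mono (kernel.ι p), kernel.lift_ι, hf]
  rw [this]
  exact hq

theorem IsCover.isIso_of_comp_eq (hfin : ∀ i, Finite (N i)) {F : SumCat N ⥤ ModuleCat.{v} A}
    {X : SumCat N} {p : homFun A X ⟶ F} (hp : IsCover p) {x : X ⟶ X} {φ : F ⟶ F} [Epi φ]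
    (h : homFunMap A x ≫ p = p ≫ φ) : IsIso x := by
  have := finite_homFun_end (A := A) hfin X
  exact isIso_of_isIso_homFunMap (FunctorMorphing.isIso_of_comp_eq hp.1 hp.2 h)

/-- If `x` fixes the generator `pt p` of `F`, then `x` is an isomorphism. -/
theorem IsCover.isIso_of_map_pt (hfin : ∀ i, Finite (N i)) {F : SumCat N ⥤ ModuleCat.{v} A}
    {X : SumCat N} {p : homFun A X ⟶ F} (hp : IsCover p) {x : X ⟶ X}
    (h : F.map x (pt p) = pt p) : IsIso x := by
  refine hp.isIso_of_comp_eq hfin (φ := 𝟙 F) (pt_injective ?_)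
  rw [pt_homFunMap_comp, h, Category.comp_id]

theorem IsMinimalPresentation.map_pt_eq_zero {F : SumCat N ⥤ ModuleCat.{v} A} {X Y : SumCat N}
    {f : X ⟶ Y} {p : homFun A X ⟶ F} (h : IsMinimalPresentation f p) : F.map f (pt p) = 0 := by
  rw [← pt_homFunMap_comp, h.comp_eq_zero]
  rfl

/-- By Yoneda, a morphism killing `pt p` is a point of `ker p`, and `Hom(Y, -)` maps onto `ker p`.
Thus the annihilator of the generator consists of the multiples of `f`. -/
theorem IsMinimalPresentation.exists_factor
    {F : SumCat N ⥤ ModuleCat.{v} A} {X Y : SumCat N}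
    {f : X ⟶ Y} {p : homFun A X ⟶ F} (h : IsMinimalPresentation f p) {Z : SumCat N} {x : X ⟶ Z}
    (hx : F.map x (pt p) = 0) : ∃ g : Y ⟶ Z, x = f ≫ g := by
  have h0 : homFunMap A x ≫ p = 0 := by
    apply pt_injective
    rw [pt_homFunMap_comp, hx]
    rfl
  obtain ⟨g, hg⟩ := (epi_iff_app_surjective _).1 h.isCover_kernel.1 Z
    (pt (kernel.lift p (homFunMap A x) h0))
  refine ⟨g, ?_⟩
  have h1 := congrArg ((kernel.ι p).app Z) hg
  have h2 : (kernel.ι p).app Z (pt (kernel.lift p (homFunMap A x) h0)) = pt (homFunMap A x) := by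
    rw [← pt_comp, kernel.lift_ι]
  have h3 : (kernel.ι p).app Z ((kernel.lift p (homFunMap A f) h.comp_eq_zero).app Z g) =
      (homFunMap A f).app Z g := by
    rw [← ConcreteCategory.comp_apply, ← NatTrans.comp_app, kernel.lift_ι]
  rw [h2, h3] at h1
  have h4 : pt (homFunMap A x) = x := Category.comp_id x
  rw [h4] at h1
  exact h1.symm

end Covers

/-! ### Isomorphisms of the form `1 + u` -/

section Preadditive

variable {C : Type*} [Category C] [Preadditive C]

/-- The ring identity relating `1 + ab` and `1 + ba`: with `v` the inverse of `𝟙 X + z ≫ t`, the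
inverse of `𝟙 M + t ≫ z` is `𝟙 M - t ≫ v ≫ z`. -/
theorem isIso_one_add_comp_comm {X M : C} (t : M ⟶ X) (z : X ⟶ M) (h : IsIso (𝟙 X + z ≫ t)) :
    IsIso (𝟙 M + t ≫ z) := by
  have h1 : inv (𝟙 X + z ≫ t) + z ≫ t ≫ inv (𝟙 X + z ≫ t) = 𝟙 X := by
    have := IsIso.hom_inv_id (𝟙 X + z ≫ t)
    rwa [Preadditive.add_comp, Category.id_comp, Category.assoc] at this
  have h2 : inv (𝟙 X + z ≫ t) + inv (𝟙 X + z ≫ t) ≫ z ≫ t = 𝟙 X := by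
    have := IsIso.inv_hom_id (𝟙 X + z ≫ t)
    rwa [Preadditive.comp_add, Category.comp_id] at this
  set v := inv (𝟙 X + z ≫ t)
  refine ⟨𝟙 M - t ≫ v ≫ z, ?_, ?_⟩
  · have h3 := congrArg (fun x => t ≫ x ≫ z) h1
    simp only [Preadditive.add_comp, Preadditive.comp_add, Category.id_comp, Category.assoc] at h3
    simp only [Preadditive.add_comp, Preadditive.comp_sub, Category.id_comp, Category.comp_id,
      Category.assoc]
    rw [← h3]
    abel
  · have h3 := congrArg (fun x => t ≫ x ≫ z) h2
    simp only [Preadditive.add_comp, Preadditive.comp_add, Category.id_comp, Category.assoc] at h3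
    simp only [Preadditive.comp_add, Preadditive.sub_comp, Category.id_comp, Category.comp_id,
      Category.assoc]
    rw [eq_sub_of_add_eq h3]
    abel

theorem isIso_one_add_of_comp_self_eq_zero {M : C} {u : M ⟶ M} (h : u ≫ u = 0) :
    IsIso (𝟙 M + u) := by
  refine ⟨𝟙 M - u, ?_, ?_⟩ <;> simp [h]

end Preadditive

/-! ### Generators of a functor -/

section Generators

set_option linter.unusedSectionVars false

variable {A : Type w} [CommRing A] {R : Type u} [Ring R] [Algebra A R] {n : ℕ}
variable {N : Fin n → ModuleCat.{v} R}
variable {F : SumCat N ⥤ ModuleCat.{v} A} {M : SumCat N}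

/-- The point `a` of `F(M)` generates the functor `F`. -/
def IsGenerator (F : SumCat N ⥤ ModuleCat.{v} A) (a : F.obj M) : Prop :=
  ∀ (Z : SumCat N) (z : F.obj Z), ∃ t : M ⟶ Z, F.map t a = z

theorem map_hom_inv (g : Aut M) (a : F.obj M) :
    F.map (toIso g).inv (F.map (toIso g).hom a) = a := by
  rw [map_map, Iso.hom_inv_id]
  simp

theorem app_hom_inv (α : Aut F) (a : F.obj M) :
    (toIso α).inv.app M ((toIso α).hom.app M a) = a := by
  rw [← ConcreteCategory.comp_apply, ← NatTrans.comp_app, Iso.hom_inv_id]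
  rfl

theorem IsGenerator.inv_app {a : F.obj M} (ha : IsGenerator F a) (α : Aut F) :
    IsGenerator F ((toIso α).inv.app M a) := by
  intro Z z
  obtain ⟨t, ht⟩ := ha Z ((toIso α).hom.app Z z)
  refine ⟨t, ?_⟩
  rw [← app_map, ht, app_hom_inv]

theorem IsGenerator.aut_eq {a : F.obj M} (ha : IsGenerator F a) {α β : Aut F}
    (h : (toIso α).inv.app M a = (toIso β).inv.app M a) : α = β := by
  apply Iso.ext_inv
  ext Z z
  obtain ⟨t, rfl⟩ := ha Z z
  change (toIso α).inv.app Z (F.map t a) = (toIso β).inv.app Z (F.map t a)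
  rw [app_map, app_map, h]

theorem mem_stab {a : F.obj M} {g : Aut M} : g ∈ stab F a ↔ F.map (toIso g).hom a = a := Iff.rfl

/-- Since `p` is onto, `a` comes from `pt p` by some `s`; since `a` generates, `pt p` comes from `a`
by some `t`. The composite `s ≫ t` fixes `pt p`, so it is invertible because `p` is a cover, and `t`
can be corrected by its inverse. In particular `X` is a summand of `M`. -/
theorem IsCover.exists_split (hfin : ∀ i, Finite (N i)) {X : SumCat N} {p : homFun A X ⟶ F}
    (hp : IsCover p) {a : F.obj M} (ha : IsGenerator F a) :
    ∃ (s : X ⟶ M) (t : M ⟶ X), s ≫ t = 𝟙 X ∧ F.map s (pt p) = a ∧ F.map t a = pt p := by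
  obtain ⟨(s : X ⟶ M), hs⟩ := (epi_iff_app_surjective p).1 hp.1 M a
  have hs' : F.map s (pt p) = a := (app_eq p s).symm.trans hs
  obtain ⟨t, ht⟩ := ha X (pt p)
  have hst : F.map (s ≫ t) (pt p) = pt p := by rw [← map_map, hs', ht]
  have := hp.isIso_of_map_pt hfin hst
  refine ⟨s, t ≫ inv (s ≫ t), ?_, hs', ?_⟩
  · rw [← Category.assoc, IsIso.hom_inv_id]
  · rw [← map_map, ht]
    conv_lhs => rw [← hst]
    rw [map_map, IsIso.hom_inv_id]
    simp

/-- A split monomorphism of modules, given by `s` and its retraction `t`, as a direct sum. -/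
def splitEquiv {R X M : Type*} [Ring R] [AddCommGroup X] [Module R X] [AddCommGroup M] [Module R M]
    (s : X →ₗ[R] M) (t : M →ₗ[R] X) (h : ∀ x, t (s x) = x) : (X × LinearMap.ker t) ≃ₗ[R] M where
  toFun y := s y.1 + y.2
  map_add' y z := by
    simp only [Prod.fst_add, Prod.snd_add, map_add, Submodule.coe_add]
    abel
  map_smul' c y := by simp
  invFun m := (t m, ⟨m - s (t m), by simp [h]⟩)
  left_inv y := by
    have : t y.2 = 0 := y.2.2
    ext <;> simp [h, this]
  right_inv m := by simp

/-- The complements `ker t` and `ker t'` are isomorphic by cancellation of `X`. Such an isomorphism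
together with the identity of `X` gives the automorphism. -/
theorem exists_aut_of_split (hfin : ∀ i, Finite (N i)) {X : SumCat N} {s s' : X ⟶ M}
    {t t' : M ⟶ X} (h : s ≫ t = 𝟙 X) (h' : s' ≫ t' = 𝟙 X) :
    ∃ g : Aut M, s ≫ (toIso g).hom = s' := by
  have := finite_obj hfin X
  have := finite_obj hfin M
  let e := splitEquiv s.hom.hom t.hom.hom fun x => congrArg (fun f => f.hom.hom x) h
  let e' := splitEquiv s'.hom.hom t'.hom.hom fun x => congrArg (fun f => f.hom.hom x) h'
  obtain ⟨ψ⟩ := nonempty_equiv_of_prod_equiv (e.trans e'.symm)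
  let g : M.obj ≃ₗ[R] M.obj := e.symm.trans (((LinearEquiv.refl R X.obj).prodCongr ψ).trans e')
  have hg : ∀ x, g (s.hom.hom x) = s'.hom.hom x := by
    intro x
    have h1 : s.hom.hom x = e (x, 0) := by simp [e, splitEquiv]
    rw [h1]
    simp [g, e', splitEquiv]
  exact ⟨ObjectProperty.isoMk _ g.toModuleIso, hom_ext_apply hg⟩

/-- Any two generators in `F(M)` are conjugate under `Aut(M)`. -/
theorem IsGenerator.exists_aut (hfin : ∀ i, Finite (N i)) {X : SumCat N} {p : homFun A X ⟶ F}
    (hp : IsCover p) {a b : F.obj M} (ha : IsGenerator F a) (hb : IsGenerator F b) :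
    ∃ g : Aut M, F.map (toIso g).hom a = b := by
  obtain ⟨s, t, h1, h2, h3⟩ := hp.exists_split hfin ha
  obtain ⟨s', t', h1', h2', h3'⟩ := hp.exists_split hfin hb
  obtain ⟨g, hg⟩ := exists_aut_of_split hfin h1 h1'
  exact ⟨g, by rw [← h2, map_map, hg, h2']⟩

/-- For each `α` the point `α⁻¹ a` is again a generator, so some `γ α` in `Aut M` moves `a` to it.
The map `(α, h) ↦ γ α * h` is injective: the product sends `a` to `α⁻¹ a`, and an automorphism of
`F` is determined by what its inverse does to a generator. -/
theorem IsGenerator.card_aut_mul_card_stab_le (hfin : ∀ i, Finite (N i)) {X : SumCat N}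
    {p : homFun A X ⟶ F} (hp : IsCover p) {a : F.obj M} (ha : IsGenerator F a) :
    Nat.card (Aut F) * Nat.card (stab F a) ≤ Nat.card (Aut M) := by
  have := finite_aut hfin M
  choose γ hγ using fun α : Aut F => ha.exists_aut hfin hp (ha.inv_app α)
  rw [← Nat.card_prod]
  refine Nat.card_le_card_of_injective (fun x : Aut F × stab F a => γ x.1 * (x.2 : Aut M)) ?_
  have key : ∀ x : Aut F × stab F a, F.map (toIso (γ x.1 * (x.2 : Aut M))).hom a = (toIso x.1).inv.app M a := by
    rintro ⟨α, g, hg⟩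
    rw [toIso_mul_hom, ← map_map, mem_stab.1 hg, hγ]
  rintro ⟨α, g⟩ ⟨β, h⟩ hxy
  have hαβ : α = β := by
    apply ha.aut_eq
    rw [← key (α, g), ← key (β, h)]
    exact congrArg (fun g => F.map (toIso g).hom a) hxy
  subst hαβ
  simpa using hxy

/-- This turns triviality of the stabiliser into a linear statement: `1 + u` is an automorphism
fixing `a`, hence the identity. -/
theorem eq_zero_of_stab_eq_bot {a : F.obj M} (hF : IsLinearFunctor F) (hstab : stab F a = ⊥)
    {u : M ⟶ M} (hu : IsIso (𝟙 M + u)) (hua : F.map u a = 0) : u = 0 := by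
  let g : Aut M := asIso (𝟙 M + u)
  have hmem : g ∈ stab F a := by
    rw [mem_stab]
    change F.map (𝟙 M + u) a = a
    rw [hF.map_add, hua]
    simp
  rw [hstab, Subgroup.mem_bot] at hmem
  have h1 : 𝟙 M + u = 𝟙 M := congrArg (fun g : Aut M => (toIso g).hom) hmem
  simpa using h1

/-- If the stabiliser of a generator is trivial, then the functor is representable. -/
theorem IsCover.isIso_of_stab_eq_bot (hfin : ∀ i, Finite (N i)) (hM : Generates M)
    (hF : IsLinearFunctor F) {X : SumCat N}
    {p : homFun A X ⟶ F} (hp : IsCover p) {a : F.obj M} (ha : IsGenerator F a)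
    (hstab : stab F a = ⊥) : IsIso p := by
  obtain ⟨s, t, h1, h2, h3⟩ := hp.exists_split hfin ha
  -- If `z : X ⟶ M` kills `pt p`, then `𝟙 X + z ≫ t` fixes `pt p` and is invertible. Hence `𝟙 M + t
  -- ≫ z` is invertible and fixes `a`, so `t ≫ z = 0`, and `z = s ≫ t ≫ z = 0`.
  have hmono : Mono p := by
    refine mono_of_injective_app hM (isLinearFunctor_homFun hfin X) p fun (z : X ⟶ M) hz => ?_
    have hz' : F.map z (pt p) = 0 := (app_eq p z).symm.trans hz
    have hiso : IsIso (𝟙 X + z ≫ t) := by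
      apply hp.isIso_of_map_pt hfin
      rw [hF.map_add, ← map_map, hz', map_zero]
      simp
    have htz : t ≫ z = 0 := by
      refine eq_zero_of_stab_eq_bot hF hstab (isIso_one_add_comp_comm t z hiso) ?_
      rw [← map_map, h3, hz']
    have : z = s ≫ t ≫ z := by rw [← Category.assoc, h1, Category.id_comp]
    rw [htz, comp_zero] at this
    exact this
  have := hp.1
  exact isIso_of_mono_of_epi p

end Generators

/-! ### Supports -/

section Support

theorem Indecomposable.of_iso {C : Type*} [Category C] [HasZeroMorphisms C]
    [HasBinaryBiproducts C] {X Y : C} (e : X ≅ Y) (h : Indecomposable X) : Indecomposable Y :=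
  ⟨fun hz => h.1 (hz.of_iso e), fun _ _ φ => h.2 _ _ (e.trans φ)⟩

theorem mem_supp_iff {C : Type*} [Category C] [Abelian C] {X : C}
    {c : Quotient (isIsomorphicSetoid C)} :
    c ∈ {c : Quotient (isIsomorphicSetoid C) |
      ∃ Y : C, Quotient.mk _ Y = c ∧ Indecomposable Y ∧ IsDirectSummand Y X} ↔
    ∃ Y : C, Quotient.mk _ Y = c ∧ Indecomposable Y ∧ Nonempty (Retract Y X) := by
  simp only [Set.mem_ofPred_eq, isDirectSummand_iff]

/-- Two splittings of the same idempotent are isomorphic. -/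
def Retract.isoOfEq {C : Type*} [Category C] {X Y Z : C} (s : Retract Y X) (t : Retract Z X)
    (h : s.r ≫ s.i = t.r ≫ t.i) : Y ≅ Z where
  hom := s.i ≫ t.r
  inv := t.i ≫ s.r
  hom_inv_id := by
    have h1 : (s.i ≫ t.r) ≫ t.i ≫ s.r = s.i ≫ (t.r ≫ t.i) ≫ s.r := by simp only [Category.assoc]
    rw [h1, ← h]
    simp
  inv_hom_id := by
    have h1 : (t.i ≫ s.r) ≫ s.i ≫ t.r = t.i ≫ (s.r ≫ s.i) ≫ t.r := by simp only [Category.assoc]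
    rw [h1, h]
    simp

/-- Every summand is the image of an endomorphism, and there are finitely many of those. Finiteness
matters because `Set.ncard` is 0 on infinite sets. -/
theorem finite_supp {R : Type u} [Ring R] (X : ModuleCat.{v} R) [Finite X] :
    {c : Quotient (isIsomorphicSetoid (ModuleCat.{v} R)) |
      ∃ Y, Quotient.mk _ Y = c ∧ Indecomposable Y ∧ IsDirectSummand Y X}.Finite := by
  have : Finite (X ⟶ X) :=
    Finite.of_injective (fun f => f.hom) fun f g h => ModuleCat.hom_ext h
  refine (Set.finite_range fun e : X ⟶ X =>
    (Quotient.mk (isIsomorphicSetoid (ModuleCat.{v} R)) (image e))).subset ?_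
  intro c hc
  obtain ⟨Y, rfl, -, ⟨s⟩⟩ := mem_supp_iff.1 hc
  refine ⟨s.r ≫ s.i, Quotient.sound ⟨?_⟩⟩
  exact (image.isoStrongEpiMono s.r s.i rfl).symm

theorem exists_indecomposable_retract {R : Type u} [Ring R] (X : ModuleCat.{v} R) [Finite X]
    (hX : ¬ IsZero X) : ∃ U, Indecomposable U ∧ Nonempty (Retract U X) := by
  obtain ⟨k, hk⟩ : ∃ k, Nat.card X = k := ⟨_, rfl⟩
  induction k using Nat.strong_induction_on generalizing X with
  | _ k ih =>
    by_cases h : ∀ e : X ⟶ X, e ≫ e = e → e = 0 ∨ e = 𝟙 X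
    · exact ⟨X, indecomposable_iff.2 ⟨hX, h⟩, ⟨Retract.refl X⟩⟩
    · push Not at h
      obtain ⟨e, he, h0, h1⟩ := h
      obtain ⟨Y, s, hs⟩ := exists_retract_of_idempotent he
      have hinj : Function.Injective s.i.hom :=
        (ModuleCat.mono_iff_injective _).1 (inferInstance : Mono s.i)
      have : Finite Y := Finite.of_injective _ hinj
      have hlt : Nat.card Y < Nat.card X := by
        refine lt_of_le_of_ne (Nat.card_le_card_of_injective _ hinj) fun hc => h1 ?_
        have hsurj := ((Nat.bijective_iff_injective_and_card _).2 ⟨hinj, hc⟩).2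
        have : Epi s.i := (ModuleCat.epi_iff_surjective _).2 hsurj
        rw [← hs, ← cancel_epi s.i]
        simp
      have hY : ¬ IsZero Y := fun hz => h0 (by rw [← hs, hz.eq_of_tgt s.r 0, zero_comp])
      obtain ⟨U, hU, ⟨t⟩⟩ := ih _ (hk ▸ hlt) Y hY rfl
      exact ⟨U, hU, ⟨t.trans s⟩⟩

variable {A : Type w} [CommRing A] {R : Type u} [Ring R] [Algebra A R] {n : ℕ}
variable {N : Fin n → ModuleCat.{v} R}

theorem homFunMap_zero (X Y : SumCat N) : homFunMap A (0 : X ⟶ Y) = 0 := by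
  apply pt_injective
  exact (Limits.zero_comp : (0 : X ⟶ Y) ≫ 𝟙 Y = 0)

theorem indecomposable_of_homFun {X : SumCat N} (h : Indecomposable (homFun A X)) :
    Indecomposable X.obj := by
  rw [indecomposable_iff] at h ⊢
  refine ⟨fun hz => h.1 ?_, fun e he => ?_⟩
  · have h1 : 𝟙 X = 0 := by
      ext1
      exact hz.eq_of_src _ _
    rw [IsZero.iff_id_eq_zero, ← homFunMap_id, h1, homFunMap_zero]
  · have he' : (ObjectProperty.homMk e : X ⟶ X) ≫ ObjectProperty.homMk e = ObjectProperty.homMk e := by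
      ext1
      exact he
    rcases h.2 (homFunMap A (ObjectProperty.homMk e : X ⟶ X)) (by rw [← homFunMap_comp, he']) with h | h
    · left
      rw [← homFunMap_zero] at h
      exact congrArg (fun f => f.hom) (homFunMap_injective h)
    · right
      rw [← homFunMap_id] at h
      exact congrArg (fun f => f.hom) (homFunMap_injective h)

/-- By Yoneda and the splitting of idempotents, an indecomposable summand of `F` is `Hom(Y, -)` for
an indecomposable summand `Y` of `X`, hence of `M`. This injects one support into the other, and
equal finite cardinalities make it onto, so every indecomposable summand of `M` already occurs in
`X`. -/
theorem supp_le_supp (hT : HasTrivialIdempotents N) (hfin : ∀ i, Finite (N i))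
    {F : SumCat N ⥤ ModuleCat.{v} A} {X M : SumCat N} (i : homFun A X ≅ F) (s : Retract X M) :
    supp F ≤ supp M.obj ∧ (supp F = supp M.obj → ∀ U : ModuleCat.{v} R, Indecomposable U →
      Nonempty (Retract U M.obj) → ∃ Y : SumCat N, Nonempty (Retract Y X) ∧
        Nonempty (Y.obj ≅ U)) := by
  have := finite_obj hfin M
  have : Nonempty (SumCat N) := ⟨M⟩
  have key : ∀ c ∈ {c : Quotient (isIsomorphicSetoid (SumCat N ⥤ ModuleCat.{v} A)) |
      ∃ Q, Quotient.mk _ Q = c ∧ Indecomposable Q ∧ IsDirectSummand Q F},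
      ∃ Y : SumCat N, Nonempty (Retract Y X) ∧ Quotient.mk _ (homFun A Y) = c ∧
        Indecomposable Y.obj := by
    intro c hc
    obtain ⟨Q, rfl, hQ, ⟨t⟩⟩ := mem_supp_iff.1 hc
    let t' : Retract Q (homFun A X) := t.trans (Retract.ofIso i.symm)
    obtain ⟨e, he⟩ := homFunMap_surjective (t'.r ≫ t'.i)
    have hee : e ≫ e = e := by
      apply homFunMap_injective (A := A)
      rw [homFunMap_comp, he]
      simp
    obtain ⟨Y, r, hr⟩ := exists_retract_of_idempotent_sumCat hT hfin hee
    let r' : Retract (homFun A Y) (homFun A X) :=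
      ⟨homFunMap A r.r, homFunMap A r.i, by rw [← homFunMap_comp, r.retract, homFunMap_id]⟩
    have hiso : homFun A Y ≅ Q := Retract.isoOfEq r' t' (by
      change homFunMap A r.i ≫ homFunMap A r.r = _
      rw [← homFunMap_comp, hr, he])
    exact ⟨Y, ⟨r⟩, Quotient.sound ⟨hiso⟩,
      indecomposable_of_homFun (Indecomposable.of_iso hiso.symm hQ)⟩
  choose! G hG using key
  set S := {c : Quotient (isIsomorphicSetoid (SumCat N ⥤ ModuleCat.{v} A)) |
      ∃ Q, Quotient.mk _ Q = c ∧ Indecomposable Q ∧ IsDirectSummand Q F} with hS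
  set T := {c : Quotient (isIsomorphicSetoid (ModuleCat.{v} R)) |
      ∃ Y, Quotient.mk _ Y = c ∧ Indecomposable Y ∧ IsDirectSummand Y M.obj} with hT'
  let f : Quotient (isIsomorphicSetoid (SumCat N ⥤ ModuleCat.{v} A)) →
    Quotient (isIsomorphicSetoid (ModuleCat.{v} R)) := fun c => Quotient.mk _ (G c).obj
  have hTfin : T.Finite := finite_supp M.obj
  have hmaps : Set.MapsTo f S T := by
    intro c hc
    obtain ⟨⟨r⟩, h2, h3⟩ := hG c hc
    exact mem_supp_iff.2 ⟨_, rfl, h3, ⟨(r.trans s).map (IsSumOf N).ι⟩⟩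
  have hinj : Set.InjOn f S := by
    intro c hc d hd hcd
    obtain ⟨-, h2, -⟩ := hG c hc
    obtain ⟨-, h2', -⟩ := hG d hd
    obtain ⟨e⟩ := Quotient.exact hcd
    rw [← h2, ← h2']
    have e' : G d ≅ G c := (ObjectProperty.isoMk _ e).symm
    exact Quotient.sound ⟨(linearCoyoneda A (SumCat N)).mapIso e'.op⟩
  refine ⟨Set.ncard_le_ncard_of_injOn f hmaps hinj hTfin, fun heq U hU hUM => ?_⟩
  have himg : f '' S = T := by
    refine Set.eq_of_subset_of_ncard_le hmaps.image_subset ?_ hTfin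
    rw [hinj.ncard_image]
    exact heq.ge
  obtain ⟨c, hc, hcU⟩ : Quotient.mk _ U ∈ f '' S := by
    rw [himg]
    exact mem_supp_iff.2 ⟨U, rfl, hU, hUM⟩
  exact ⟨G c, (hG c hc).1, Quotient.exact hcU⟩

/-- Suppose that `X` has a non-zero complement `Z` in `M`. An indecomposable summand of `Z` also
occurs in `X`, so there is a non-zero `x : M ⟶ X` through `Z` with `s ≫ x = 0`. Then `x ≫ s` has
square zero and kills the generator, so it vanishes by triviality of the stabiliser. As `s` is split
mono, `x = 0`, a contradiction. -/
theorem nonempty_iso_of_supp_eq (hT : HasTrivialIdempotents N) (hfin : ∀ i, Finite (N i))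
    {F : SumCat N ⥤ ModuleCat.{v} A} (hF : IsLinearFunctor F) {X M : SumCat N}
    {p : homFun A X ⟶ F} [IsIso p] {s : X ⟶ M} {t : M ⟶ X} (hst : s ≫ t = 𝟙 X)
    (hstab : stab F (F.map s (pt p)) = ⊥) (hsupp : supp F = supp M.obj) : Nonempty (X ≅ M) := by
  refine ⟨⟨s, t, hst, ?_⟩⟩
  by_contra hne
  obtain ⟨Z, r, hr⟩ := exists_retract_of_idempotent_sumCat hT hfin
    (X := M) (e := 𝟙 M - t ≫ s) (by simp [reassoc_of% hst])
  have hZ : ¬ IsZero Z.obj := by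
    intro hz
    have h0 : r.r = 0 := by
      ext1
      exact hz.eq_of_tgt _ _
    rw [h0, zero_comp] at hr
    exact hne (sub_eq_zero.1 hr.symm).symm
  have := finite_obj hfin Z
  obtain ⟨U, hU, ⟨q⟩⟩ := exists_indecomposable_retract Z.obj hZ
  obtain ⟨Y, ⟨y⟩, ⟨e⟩⟩ := (supp_le_supp hT hfin (asIso p) ⟨s, t, hst⟩).2 hsupp U hU
    ⟨q.trans (r.map (IsSumOf N).ι)⟩
  let f : Z ⟶ Y := ObjectProperty.homMk (q.r ≫ e.inv)
  let g : Y ⟶ Z := ObjectProperty.homMk (e.hom ≫ q.i)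
  have hgf : g ≫ f = 𝟙 Y := by
    ext1
    change (e.hom ≫ q.i) ≫ q.r ≫ e.inv = 𝟙 _
    simp
  have hsr : s ≫ r.r = 0 := by
    rw [← cancel_mono r.i, Category.assoc, hr]
    simp [reassoc_of% hst]
  let x : M ⟶ X := r.r ≫ f ≫ y.i
  have hsx : s ≫ x = 0 := by
    change s ≫ r.r ≫ f ≫ y.i = 0
    rw [← Category.assoc, hsr, zero_comp]
  have h0 : x ≫ s = 0 := by
    refine eq_zero_of_stab_eq_bot hF hstab (isIso_one_add_of_comp_self_eq_zero ?_) ?_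
    · rw [Category.assoc, ← Category.assoc s, hsx, zero_comp, comp_zero]
    · rw [map_map, ← Category.assoc, hsx, zero_comp, hF.map_zero]
  have hx : x = 0 := by
    rw [← Category.comp_id x, ← hst, ← Category.assoc, h0, zero_comp]
  have h1 : g ≫ r.i ≫ x ≫ y.r = 𝟙 Y := by
    change g ≫ r.i ≫ (r.r ≫ f ≫ y.i) ≫ y.r = 𝟙 Y
    simp [hgf]
  rw [hx] at h1
  simp only [zero_comp, comp_zero] at h1
  have hYzero : IsZero Y.obj := by
    rw [IsZero.iff_id_eq_zero]
    exact (congrArg (fun f => f.hom) h1).symm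
  exact hU.1 (hYzero.of_iso e.symm)

end Support

/-! ### Averaging over a finite group -/

section Averaging

variable {K : Type*} [Field K] [CharZero K] {G : Type*} [Group G] [Finite G]
variable {U V : Type*} [AddCommGroup U] [Module K U] [AddCommGroup V] [Module K V]
variable {τ : Representation K G U} {ρ : Representation K G V}

/-- The test map `l` records what survives averaging: a value that `l` takes on every summand is
taken on the average. With `l` the surjection this yields sections, with `l` the identity it yields
extensions. -/
theorem exists_average (τ : Representation K G U) (ρ : Representation K G V) (f : U →ₗ[K] V) :
    ∃ F : τ.IntertwiningMap ρ, ∀ {W : Type _} [AddCommGroup W] [Module K W] (l : V →ₗ[K] W) x y,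
      (∀ g, l (ρ g⁻¹ (f (τ g x))) = y) → l (F x) = y := by
  have hc : (Nat.card G : K) ≠ 0 := Nat.cast_ne_zero.2 Nat.card_pos.ne'
  have := Fintype.ofFinite G
  let F : U →ₗ[K] V := (Nat.card G : K)⁻¹ • ∑ g : G, ρ g⁻¹ ∘ₗ f ∘ₗ τ g
  have hF : ∀ x, F x = (Nat.card G : K)⁻¹ • ∑ g : G, ρ g⁻¹ (f (τ g x)) := fun x => by
    simp [F, LinearMap.sum_apply]
  refine ⟨F.intertwiningMap_of_isIntertwiningMap τ ρ fun h x => ?_, fun l x y hx => ?_⟩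
  · rw [hF, hF, map_smul, map_sum, ← Equiv.sum_comp (Equiv.mulRight h⁻¹)]
    congr 1
    refine Finset.sum_congr rfl fun g _ => ?_
    simp only [Equiv.coe_mulRight, mul_inv_rev, inv_inv, map_mul, Module.End.mul_apply]
    rw [← Module.End.mul_apply (τ h⁻¹), ← map_mul]
    simp
  · rw [LinearMap.toIntertwiningMap, hF, map_smul, map_sum, Finset.sum_congr rfl fun g _ => hx g, Finset.sum_const,
      ← Nat.cast_smul_eq_nsmul K, Finset.card_univ, ← Nat.card_eq_fintype_card, smul_smul,
      inv_mul_cancel₀ hc, one_smul]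

theorem exists_section (f : τ.IntertwiningMap ρ) (hf : Function.Surjective f) :
    ∃ s : ρ.IntertwiningMap τ, ∀ v, f (s v) = v := by
  obtain ⟨s, hs⟩ := f.toLinearMap.exists_rightInverse_of_surjective (LinearMap.range_eq_top.2 hf)
  obtain ⟨S, hS⟩ := exists_average ρ τ s
  refine ⟨S, fun v => hS f.toLinearMap _ _ fun g => ?_⟩
  have h1 : f (s (ρ g v)) = ρ g v := LinearMap.congr_fun hs _
  change f (τ g⁻¹ (s (ρ g v))) = v
  rw [f.isIntertwining, h1, ← Module.End.mul_apply, ← map_mul]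
  simp

theorem exists_extension (T : Subrepresentation τ) (f : T.toRepresentation.IntertwiningMap ρ) :
    ∃ F : τ.IntertwiningMap ρ, ∀ x : T.toSubmodule, F x = f x := by
  obtain ⟨f', hf'⟩ := LinearMap.exists_extend f.toLinearMap
  have hf : ∀ x : T.toSubmodule, f' x = f x := fun x => LinearMap.congr_fun hf' x
  obtain ⟨F, hF⟩ := exists_average τ ρ f'
  refine ⟨F, fun x => hF LinearMap.id _ _ fun g => ?_⟩
  have h1 : f' (τ g x) = ρ g (f x) := by
    rw [← f.isIntertwining]
    exact hf (T.toRepresentation g x)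
  rw [LinearMap.id_apply, h1, ← Module.End.mul_apply, ← map_mul]
  simp

theorem nontrivial_of_isIrreducible {K G V : Type*} [Field K] [Group G] [AddCommGroup V]
    [Module K V] {ρ : Representation K G V} (hρ : ρ.IsIrreducible) : Nontrivial V := by
  by_contra h
  rw [not_nontrivial_iff_subsingleton] at h
  obtain ⟨a, b, hab⟩ := hρ.toNontrivial
  apply hab
  ext x
  rw [Subsingleton.elim x 0]
  exact ⟨fun _ => b.toSubmodule.zero_mem, fun _ => a.toSubmodule.zero_mem⟩

/-- An irreducible representation that is a quotient of `τ` is a subrepresentation of `τ`. -/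
theorem exists_injective_of_ne_zero (hρ : ρ.IsIrreducible) {f : τ.IntertwiningMap ρ}
    (hf : f ≠ 0) : ∃ φ : ρ.IntertwiningMap τ, Function.Injective φ := by
  obtain ⟨s, hs⟩ := exists_section f
    ((Representation.IsIrreducible.surjective_or_eq_zero f).resolve_right hf)
  exact ⟨s, Function.LeftInverse.injective hs⟩

end Averaging

/-! ### Generic points -/

section Generic

set_option linter.unusedSectionVars false

variable {A : Type w} [CommRing A] {R : Type u} [Ring R] [Algebra A R] {n : ℕ}
variable {N : Fin n → ModuleCat.{v} R}
variable {F : SumCat N ⥤ ModuleCat.{v} A} {M : SumCat N}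
variable {K : Type*} [Field K] {V : Type*} [AddCommGroup V] [Module K V]
variable {ρ : Representation K (Aut M) V}

@[simp] theorem permRep_single (g : Aut M) (x : F.obj M) (c : K) :
    permRep K F M g (Finsupp.single x c) = Finsupp.single (F.map (toIso g).hom x) c :=
  Finsupp.mapDomain_single

@[simp] theorem autRep_single (α : Aut F) (x : F.obj M) (c : K) :
    autRep K F M α (Finsupp.single x c) = Finsupp.single ((toIso α).hom.app M x) c :=
  Finsupp.mapDomain_single

theorem mem_fixedSpace {H : Subgroup (Aut M)} {v : V} :
    v ∈ fixedSpace ρ H ↔ ∀ h ∈ H, ρ h v = v := by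
  rw [fixedSpace, Representation.mem_invariants]
  exact ⟨fun h g hg => h ⟨g, hg⟩, fun h g => h g g.2⟩

theorem isGeneric_iff {a : F.obj M} :
    IsGeneric ρ F a ↔ ∃ v, v ≠ 0 ∧ ∀ h ∈ stab F a, ρ h v = v := by
  rw [IsGeneric, Submodule.ne_bot_iff]
  simp only [mem_fixedSpace, and_comm]

/-- An intertwining map `KF(M) → V` may be prescribed at a point, up to the obvious condition. -/
theorem exists_intertwiningMap {a : F.obj M} {v : V} (hv : ∀ h ∈ stab F a, ρ h v = v) :
    ∃ f : (permRep K F M).IntertwiningMap ρ, f (Finsupp.single a 1) = v := by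
  classical
  -- The map sends `g a` to `ρ g v` and is zero off the orbit of `a`; the choice of `g` does not
  -- matter because `Stab(a)` fixes `v`.
  let κ : F.obj M → V := fun x =>
    if h : ∃ g : Aut M, F.map (toIso g).hom a = x then ρ h.choose v else 0
  have hκ : ∀ g : Aut M, κ (F.map (toIso g).hom a) = ρ g v := by
    intro g
    have h : ∃ g' : Aut M, F.map (toIso g').hom a = F.map (toIso g).hom a := ⟨g, rfl⟩
    have h1 : κ (F.map (toIso g).hom a) = ρ h.choose v := dif_pos h
    have h2 : g⁻¹ * h.choose ∈ stab F a := by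
      rw [mem_stab, toIso_mul_hom, ← map_map, h.choose_spec, toIso_inv_hom, map_hom_inv]
    have h3 := congrArg (ρ g) (hv _ h2)
    rw [← Module.End.mul_apply, ← map_mul, mul_inv_cancel_left] at h3
    rw [h1, h3]
  have hκ0 : ∀ x, (¬ ∃ g : Aut M, F.map (toIso g).hom a = x) → κ x = 0 := fun x hx => dif_neg hx
  refine ⟨(Finsupp.linearCombination K κ).intertwiningMap_of_isIntertwiningMap _ _
    fun g x => ?_, ?_⟩
  · induction x using Finsupp.induction_linear with
    | zero => simp
    | add x y hx hy => rw [map_add, map_add, map_add, map_add, hx, hy]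
    | single x c =>
      rw [permRep_single, Finsupp.linearCombination_single, Finsupp.linearCombination_single,
        map_smul]
      congr 1
      by_cases hx : ∃ g : Aut M, F.map (toIso g).hom a = x
      · obtain ⟨g', rfl⟩ := hx
        rw [map_map, ← toIso_mul_hom, hκ, hκ, map_mul, Module.End.mul_apply]
      · rw [hκ0 x hx, map_zero, hκ0]
        rintro ⟨g', hg'⟩
        apply hx
        refine ⟨g⁻¹ * g', ?_⟩
        rw [toIso_mul_hom, ← map_map, hg', toIso_inv_hom, map_hom_inv]
  · rw [LinearMap.toIntertwiningMap, Finsupp.linearCombination_single, one_smul]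
    have := hκ 1
    simpa using this

theorem IntertwiningMap.apply_single_map (f : (permRep K F M).IntertwiningMap ρ) (g : Aut M)
    (a : F.obj M) (c : K) :
    f (Finsupp.single (F.map (toIso g).hom a) c) = ρ g (f (Finsupp.single a c)) := by
  rw [← f.isIntertwining, permRep_single]

theorem IntertwiningMap.apply_single_fixed (f : (permRep K F M).IntertwiningMap ρ)
    (a : F.obj M) (c : K) : ∀ h ∈ stab F a, ρ h (f (Finsupp.single a c)) = f (Finsupp.single a c) := by
  intro h hh
  rw [← IntertwiningMap.apply_single_map, mem_stab.1 hh]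

theorem IntertwiningMap.eq_of_single {f f' : (permRep K F M).IntertwiningMap ρ}
    (h : ∀ x, f (Finsupp.single x 1) = f' (Finsupp.single x 1)) : f = f' := by
  apply Representation.IntertwiningMap.ext
  ext x
  exact h x

variable [CharZero K]

theorem exists_injective_of_isGeneric (hfin : ∀ i, Finite (N i)) (hρ : ρ.IsIrreducible)
    {a : F.obj M} (ha : IsGeneric ρ F a) :
    ∃ φ : ρ.IntertwiningMap (permRep K F M), Function.Injective φ := by
  have := finite_aut hfin M
  obtain ⟨v, hv, h⟩ := isGeneric_iff.1 ha
  obtain ⟨f, hf⟩ := exists_intertwiningMap h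
  refine exists_injective_of_ne_zero hρ (f := f) fun h0 => hv ?_
  rw [← hf, h0]
  rfl

/-- Choose `a` at which some `φ v` has a non-zero coefficient. Summing `v` over `Stab(a)` gives a
fixed vector, and the coefficient at `a` is only multiplied by `|Stab(a)|`, which is non-zero in
characteristic 0. -/
theorem exists_isGeneric (hfin : ∀ i, Finite (N i)) (hρ : ρ.IsIrreducible)
    {φ : ρ.IntertwiningMap (permRep K F M)} (hφ : Function.Injective φ) :
    ∃ a : F.obj M, IsGeneric ρ F a := by
  have := finite_aut hfin M
  have := nontrivial_of_isIrreducible hρ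
  obtain ⟨v, hv⟩ := exists_ne (0 : V)
  have hφv : φ v ≠ 0 := fun h => hv (hφ (h.trans (map_zero φ).symm))
  obtain ⟨a, ha⟩ := Finsupp.ne_iff.1 hφv
  have := Fintype.ofFinite (stab F a)
  refine ⟨a, isGeneric_iff.2 ⟨∑ h : stab F a, ρ h v, fun h0 => ?_, fun g hg => ?_⟩⟩
  · have h1 : ∀ h : stab F a, φ (ρ h v) a = φ v a := by
      intro h
      rw [φ.isIntertwining]
      have h2 : F.map (toIso (h : Aut M)).hom a = a := h.2
      have hinj : Function.Injective (F.map (toIso (h : Aut M)).hom) :=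
        Function.LeftInverse.injective (map_hom_inv (F := F) (h : Aut M))
      change Finsupp.mapDomain (F.map (toIso (h : Aut M)).hom) (φ v) a = _
      exact (congrArg _ h2.symm).trans (Finsupp.mapDomain_apply hinj _ _)
    have h2 : (φ (∑ h : stab F a, ρ h v)) a = ∑ h : stab F a, φ v a := by
      rw [map_sum, Finsupp.finsetSum_apply]
      exact Finset.sum_congr rfl fun h _ => h1 h
    rw [h0, map_zero, Finset.sum_const, nsmul_eq_mul] at h2
    have h3 : ((Finset.univ : Finset (stab F a)).card : K) ≠ 0 := by
      rw [Finset.card_univ, Nat.cast_ne_zero]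
      exact Fintype.card_ne_zero
    exact (mul_ne_zero h3 ha) h2.symm
  · rw [map_sum, ← Equiv.sum_comp (Equiv.mulLeft (⟨g, hg⟩ : stab F a)) (fun h => ρ h v)]
    refine Finset.sum_congr rfl fun h _ => ?_
    rw [← Module.End.mul_apply, ← map_mul]
    rfl

/-- If `V` is `F`-typical, then every generic point generates `F`. -/
theorem IsTypical.isGenerator (hfin : ∀ i, Finite (N i)) (hρ : ρ.IsIrreducible)
    (hF : IsLinearFunctor F) (h : IsTypical ρ F) {a : F.obj M} (ha : IsGeneric ρ F a) :
    IsGenerator F a := by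
  let q := pointMap hF a
  let G := image q
  let i : G ⟶ F := image.ι q
  let a' : G.obj M := pt (factorThruImage q)
  have hi := (mono_iff_app_injective i).1 inferInstance
  have ha' : i.app M a' = a := by
    rw [← pt_comp, image.fac, pt_pointMap]
  have hstab : stab G a' = stab F a := by
    ext g
    rw [mem_stab, mem_stab, ← (hi M).eq_iff, app_map, ha']
  have hG : IsLinearFunctor G := hF.of_mono i
  have hgen : IsGeneric ρ G a' := by
    rw [IsGeneric, hstab]
    exact ha
  -- `G` is the subfunctor generated by `a`, and `a` has the same stabiliser in `G(M)`. So `V`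
  -- embeds in `KG(M)`, and typicality excludes `G ≺ F`.
  have hiso : Nonempty (G ≅ F) := by
    by_contra hne
    exact h.2 G hG ⟨⟨G, i, 𝟙 G, inferInstance, inferInstance⟩, not_nonempty_iff.1 hne⟩
      (exists_injective_of_isGeneric hfin hρ hgen)
  obtain ⟨e⟩ := hiso
  intro Z z
  have := hF.finite Z
  have := hG.finite Z
  -- The isomorphism `G ≅ F` need not be the inclusion `i`; it gives equal finite cardinalities,
  -- which make `i` onto.
  have hsurj : Function.Surjective (i.app Z) := by
    have hcard : Nat.card (G.obj Z) = Nat.card (F.obj Z) :=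
      Nat.card_congr (e.app Z).toLinearEquiv.toEquiv
    exact ((Nat.bijective_iff_injective_and_card _).2 ⟨hi Z, hcard⟩).2
  obtain ⟨y, rfl⟩ := hsurj z
  have hepi : Epi (factorThruImage q) := inferInstance
  obtain ⟨(t : M ⟶ Z), rfl⟩ := (epi_iff_app_surjective _).1 hepi Z y
  refine ⟨t, ?_⟩
  rw [← ha', ← app_map]
  congr 1
  exact (app_eq _ t).symm

/-- A non-zero `f` has an equivariant section, whose image is a copy of `V`. By typicality this copy
receives no non-zero map from any `KG(M)` with `G ≺ F`, so it lies in the top layer. -/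
theorem exists_section_topLayer (hfin : ∀ i, Finite (N i)) (hρ : ρ.IsIrreducible)
    (h : IsTypical ρ F) (f : (permRep K F M).IntertwiningMap ρ) (x : F.obj M →₀ K) :
    ∃ y ∈ (topLayer K F M).toSubmodule, f y = f x := by
  have := finite_aut hfin M
  by_cases hf : f = 0
  · refine ⟨0, Submodule.zero_mem _, ?_⟩
    rw [hf]
    rfl
  obtain ⟨s, hs⟩ := exists_section f
    ((Representation.IsIrreducible.surjective_or_eq_zero f).resolve_right hf)
  refine ⟨s (f x), ?_, hs _⟩
  have hred : IsReduced K F M (s.range) := by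
    intro G hG hGF ψ
    by_contra hψ
    refine h.2 G hG hGF (exists_injective_of_ne_zero hρ (f :=
      (f.toLinearMap ∘ₗ (s.range).toSubmodule.subtype ∘ₗ
        ψ.toLinearMap).intertwiningMap_of_isIntertwiningMap _ _ fun g y => ?_) fun h0 => hψ ?_)
    · change f (ψ (permRep K G M g y) : F.obj M →₀ K) = ρ g (f (ψ y : F.obj M →₀ K))
      rw [ψ.isIntertwining, ← f.isIntertwining]
      rfl
    · apply Representation.IntertwiningMap.ext
      apply LinearMap.ext
      intro y
      obtain ⟨v, hv⟩ := (ψ y).2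
      have h1 : f (ψ y : F.obj M →₀ K) = 0 := DFunLike.congr_fun h0 y
      have hv' : s v = (ψ y : F.obj M →₀ K) := hv
      rw [← hv', hs] at h1
      apply Subtype.ext
      change (ψ y : F.obj M →₀ K) = 0
      rw [← hv', h1, map_zero]
  exact (le_iSup₂_of_le (f := fun (U : Subrepresentation (permRep K F M))
    (_ : IsReduced K F M U) => U.toSubmodule) s.range hred le_rfl) ⟨f x, rfl⟩

/-- Restriction of intertwining maps from `KF(M)` to its top layer. -/
noncomputable def restrictTopLayer (ρ : Representation K (Aut M) V) (F : SumCat N ⥤ ModuleCat.{v} A) :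
    (permRep K F M).IntertwiningMap ρ →ₗ[K]
      (topLayer K F M).toRepresentation.IntertwiningMap ρ where
  toFun f := (f.toLinearMap ∘ₗ
    (topLayer K F M).toSubmodule.subtype).intertwiningMap_of_isIntertwiningMap _ _
      fun g x => Representation.IntertwiningMap.isIntertwining _ _ f g x
  map_add' _ _ := rfl
  map_smul' _ _ := rfl

/-- Every `f` has the same image on the top layer as on `KF(M)`, so restriction is injective;
Maschke gives the extensions. Thus the top layer may be replaced by the whole of `KF(M)`. -/
theorem bijective_restrictTopLayer (hfin : ∀ i, Finite (N i)) (hρ : ρ.IsIrreducible)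
    (h : IsTypical ρ F) : Function.Bijective (restrictTopLayer ρ F) := by
  have := finite_aut hfin M
  constructor
  · rw [injective_iff_map_eq_zero]
    intro f hf
    apply Representation.IntertwiningMap.ext
    apply LinearMap.ext
    intro x
    obtain ⟨y, hy, hyx⟩ := exists_section_topLayer hfin hρ h f x
    change f x = 0
    rw [← hyx]
    exact DFunLike.congr_fun hf (⟨y, hy⟩ : (topLayer K F M).toSubmodule)
  · intro f
    obtain ⟨f', hf'⟩ := exists_extension _ f
    refine ⟨f', ?_⟩
    apply Representation.IntertwiningMap.ext
    apply LinearMap.ext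
    exact hf'

/-- Evaluation of intertwining maps `KF(M) → V` at a point of `F(M)`. -/
noncomputable def evalPoint (ρ : Representation K (Aut M) V) (a : F.obj M) :
    (permRep K F M).IntertwiningMap ρ →ₗ[K] fixedSpace ρ (stab F a) where
  toFun f := ⟨f (Finsupp.single a 1), mem_fixedSpace.2 (IntertwiningMap.apply_single_fixed f a 1)⟩
  map_add' _ _ := rfl
  map_smul' _ _ := rfl

/-- Frobenius reciprocity on one orbit. The value at any `b` is fixed by `Stab(b)`, so it vanishes
unless `b` is generic, that is, unless `b` lies in the orbit of `a`. -/
theorem bijective_evalPoint {a : F.obj M}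
    (horb : ∀ b, IsGeneric ρ F b → ∃ g : Aut M, F.map (toIso g).hom a = b) :
    Function.Bijective (evalPoint (F := F) ρ a) := by
  constructor
  · rw [injective_iff_map_eq_zero]
    intro f hf
    have hf' : f (Finsupp.single a 1) = 0 := congrArg Subtype.val hf
    apply IntertwiningMap.eq_of_single
    intro b
    change f (Finsupp.single b 1) = 0
    by_cases hb : IsGeneric ρ F b
    · obtain ⟨g, rfl⟩ := horb b hb
      rw [IntertwiningMap.apply_single_map, hf', map_zero]
    · by_contra hne
      exact hb (isGeneric_iff.2 ⟨_, hne, IntertwiningMap.apply_single_fixed f b 1⟩)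
  · rintro ⟨v, hv⟩
    obtain ⟨f, hf⟩ := exists_intertwiningMap (mem_fixedSpace.1 hv)
    exact ⟨f, Subtype.ext hf⟩

/-- The composite `W ≅ Hom(top layer, V) ≅ Hom(KF(M), V) ≅ V^H`. As `α` acts by precomposition with
`α⁻¹`, the value at `u_a` becomes the value at `u_{α⁻¹ a} = u_{g a}`, which is `ρ g` applied to the
old value. -/
theorem exists_equiv_fixedSpace (hfin : ∀ i, Finite (N i)) (hρ : ρ.IsIrreducible)
    (h : IsTypical ρ F) {W : Type*} [AddCommGroup W] [Module K W] {σ : Representation K (Aut F) W}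
    (E : σ.Equiv (morphRep ρ F)) {a : F.obj M}
    (horb : ∀ b, IsGeneric ρ F b → ∃ g : Aut M, F.map (toIso g).hom a = b) :
    ∃ e : W ≃ₗ[K] fixedSpace ρ (stab F a),
      ∀ (α : Aut F) (g : Aut M), F.map (toIso g).hom a = (toIso α).inv.app M a →
        ∀ w : W, (e (σ α w) : V) = ρ g (e w : V) := by
  let r := LinearEquiv.ofBijective _ (bijective_restrictTopLayer hfin hρ h)
  let ev := LinearEquiv.ofBijective _ (bijective_evalPoint horb)
  refine ⟨E.toLinearEquiv.trans (r.symm.trans ev), fun α g hg w => ?_⟩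
  obtain ⟨f, hf⟩ := r.surjective (E w)
  let f' : (permRep K F M).IntertwiningMap ρ :=
    (f.toLinearMap ∘ₗ autRep K F M α⁻¹).intertwiningMap_of_isIntertwiningMap _ _ fun g x => by
      change f (autRep K F M α⁻¹ (permRep K F M g x)) = ρ g (f (autRep K F M α⁻¹ x))
      rw [autRep_comm, f.isIntertwining]
  have hf' : r f' = E (σ α w) := by
    have h1 : E (σ α w) = morphRep ρ F α (E w) := 
      Representation.IntertwiningMap.isIntertwining _ _ E.toIntertwiningMap α w
    rw [h1, ← hf]
    rfl
  have h1 : r.symm (E w) = f := by rw [← hf, r.symm_apply_apply]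
  have h2 : r.symm (E (σ α w)) = f' := by rw [← hf', r.symm_apply_apply]
  change (ev (r.symm (E (σ α w))) : V) = ρ g (ev (r.symm (E w)) : V)
  rw [h1, h2]
  change f (autRep K F M α⁻¹ (Finsupp.single a 1)) = ρ g (f (Finsupp.single a 1))
  rw [autRep_single, toIso_inv_hom, ← hg, IntertwiningMap.apply_single_map]

end Generic

/-! ### The automorphism group of a functor in terms of a minimal presentation -/

section Presentation

set_option linter.unusedSectionVars false

variable {A : Type w} [CommRing A] {R : Type u} [Ring R] [Algebra A R] {n : ℕ}
variable {N : Fin n → ModuleCat.{v} R}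
variable {F : SumCat N ⥤ ModuleCat.{v} A} {X Y : SumCat N} {f : X ⟶ Y} {p : homFun A X ⟶ F}

theorem map_pt_one_add (hF : IsLinearFunctor F) (h : IsMinimalPresentation f p) (g : Y ⟶ X) :
    F.map (𝟙 X + f ≫ g) (pt p) = pt p := by
  rw [hF.map_add, ← map_map, h.map_pt_eq_zero, map_zero]
  simp

theorem homFunMap_comp_eq_iff {x : X ⟶ X} : homFunMap A x ≫ p = p ↔ F.map x (pt p) = pt p := by
  constructor
  · intro h
    rw [← pt_homFunMap_comp, h]
  · intro h
    apply pt_injective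
    rw [pt_homFunMap_comp, h]

/-- `x` fixes `pt p` exactly when `x - 1` kills it, that is, factors through `f`. So `B_F` is the
stabiliser of the generator in `Aut(X)`. -/
theorem mem_groupB_iff (hF : IsLinearFunctor F) (h : IsMinimalPresentation f p) {x : Aut X} :
    x ∈ groupB f ↔ F.map (toIso x).hom (pt p) = pt p := by
  constructor
  · rintro ⟨g, hg⟩
    rw [hg, map_pt_one_add hF h]
  · intro hx
    have h0 : F.map ((toIso x).hom - 𝟙 X) (pt p) = 0 := by
      have h1 := hF.map_add ((toIso x).hom - 𝟙 X) (𝟙 X) (pt p)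
      rw [sub_add_cancel, hx] at h1
      simpa using h1
    obtain ⟨g, hg⟩ := h.exists_factor h0
    exact ⟨g, by rw [← hg]; abel⟩

theorem groupB_le_groupA (hF : IsLinearFunctor F) (h : IsMinimalPresentation f p) :
    groupB f ≤ groupA p := fun _ hx =>
  ⟨1, (homFunMap_comp_eq_iff.2 ((mem_groupB_iff hF h).1 hx)).trans (Category.comp_id p).symm⟩

theorem aut_eq_of_comp_eq (hp : Epi p) {φ ψ : Aut F}
    (h : p ≫ (toIso φ).hom = p ≫ (toIso ψ).hom) : φ = ψ :=
  Iso.ext ((cancel_epi p).1 h)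

theorem exists_lift_inv (x : groupA p) :
    ∃ φ : Aut F, homFunMap A (toIso (x : Aut X)).inv ≫ p = p ≫ (toIso φ).hom :=
  (groupA p).inv_mem x.2

/-- The homomorphism `A_F → Aut(F)` given by a presentation. -/
noncomputable def groupAHom (hp : Epi p) : groupA p →* Aut F :=
  -- Precomposition reverses products, so `x` is sent to the automorphism lifted by `x⁻¹`.
  MonoidHom.mk' (fun x => (exists_lift_inv x).choose) fun x y => by
    apply aut_eq_of_comp_eq hp
    rw [← (exists_lift_inv (x * y)).choose_spec, toIso_mul_hom,
      ← reassoc_of% (exists_lift_inv y).choose_spec, ← (exists_lift_inv x).choose_spec,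
      ← Category.assoc, ← homFunMap_comp]
    rfl

theorem groupAHom_spec (hp : Epi p) (x : groupA p) :
    homFunMap A (toIso (x : Aut X)).inv ≫ p = p ≫ (toIso (groupAHom hp x)).hom :=
  (exists_lift_inv x).choose_spec

theorem ker_groupAHom (hF : IsLinearFunctor F) (h : IsMinimalPresentation f p) :
    (groupAHom h.isCover.1).ker = (groupB f).subgroupOf (groupA p) := by
  ext x
  have hx := groupAHom_spec h.isCover.1 x
  rw [MonoidHom.mem_ker, Subgroup.mem_subgroupOf, ← Subgroup.inv_mem_iff, mem_groupB_iff hF h,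
    ← homFunMap_comp_eq_iff, toIso_inv_hom, hx]
  constructor
  · intro h1
    rw [h1]
    exact Category.comp_id p
  · intro h1
    exact aut_eq_of_comp_eq h.isCover.1 (h1.trans (Category.comp_id p).symm)

theorem surjective_groupAHom (hfin : ∀ i, Finite (N i)) (hp : IsCover p) :
    Function.Surjective (groupAHom hp.1) := by
  intro φ
  -- Projectivity of `Hom(X, -)` in Yoneda form: `p ≫ φ` lifts along `p` because `p` is onto at `X`.
  obtain ⟨(x : X ⟶ X), hx⟩ := (epi_iff_app_surjective p).1 hp.1 X (pt (p ≫ (toIso φ).hom))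
  have hx' : homFunMap A x ≫ p = p ≫ (toIso φ).hom := by
    apply pt_injective
    rw [pt_homFunMap_comp, ← hx]
    exact (app_eq p x).symm
  have := hp.isIso_of_comp_eq hfin hx'
  let g : Aut X := asIso x
  have hg : g ∈ groupA p := ⟨φ, hx'⟩
  refine ⟨⟨g, hg⟩⁻¹, aut_eq_of_comp_eq hp.1 ?_⟩
  rw [← groupAHom_spec]
  exact hx'

theorem exists_quotient_equiv (hfin : ∀ i, Finite (N i)) (hF : IsLinearFunctor F)
    (h : IsMinimalPresentation f p) :
    ∃ (_ : ((groupB f).subgroupOf (groupA p)).Normal)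
      (e : (groupA p ⧸ (groupB f).subgroupOf (groupA p)) ≃* Aut F),
      ∀ x : groupA p, homFunMap A (toIso (x : Aut X)).inv ≫ p =
        p ≫ (toIso (e (QuotientGroup.mk x))).hom := by
  have hker := ker_groupAHom hF h
  have hnormal : ((groupB f).subgroupOf (groupA p)).Normal := hker ▸ inferInstance
  exact ⟨hnormal, (QuotientGroup.quotientMulEquivOfEq hker.symm).trans
    (QuotientGroup.quotientKerEquivOfSurjective _ (surjective_groupAHom hfin h.isCover)),
    groupAHom_spec h.isCover.1⟩

/-- The kernel of `p` is zero, so the zero summand of `Hom(Y, -)` already maps onto it; minimality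
gives `Hom(Y, -) = 0`. -/
theorem IsMinimalPresentation.isZero_of_isIso
    (h : IsMinimalPresentation f p) (hp : IsIso p) : IsZero Y := by
  have hz : IsZero (kernel p) := by
    rw [IsZero.iff_id_eq_zero, ← cancel_mono (kernel.ι p), ← cancel_mono p]
    simp
  let s : Retract (kernel p) (homFun A Y) := ⟨0, 0, hz.eq_of_src _ _⟩
  have := h.isCover_kernel.2 _ s ⟨fun g g' _ => hz.eq_of_src _ _⟩
  have hY : IsZero (homFun A Y) := hz.of_iso (asIso s.i).symm
  rw [IsZero.iff_id_eq_zero]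
  apply homFunMap_injective (A := A)
  exact hY.eq_of_src _ _

end Presentation

/-! ### Functor morphing -/

section Morphing

set_option linter.unusedSectionVars false

variable {A : Type w} [CommRing A] {R : Type u} [Ring R] [Algebra A R] {n : ℕ}
variable {N : Fin n → ModuleCat.{v} R}
variable {F : SumCat N ⥤ ModuleCat.{v} A} {M : SumCat N}
variable {K : Type*} [Field K] {V : Type*} [AddCommGroup V] [Module K V]
variable {ρ : Representation K (Aut M) V}

theorem IsGeneric.map {a : F.obj M} (h : IsGeneric ρ F a) (g : Aut M) :
    IsGeneric ρ F (F.map (toIso g).hom a) := by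
  obtain ⟨v, hv, hfix⟩ := isGeneric_iff.1 h
  refine isGeneric_iff.2 ⟨ρ g v, fun h0 => hv ?_, fun x hx => ?_⟩
  · have h1 := congrArg (ρ g⁻¹) h0
    rw [← Module.End.mul_apply, ← map_mul] at h1
    simpa using h1
  · have h2 : g⁻¹ * x * g ∈ stab F a := by
      rw [mem_stab] at hx ⊢
      rw [toIso_mul_hom, toIso_mul_hom, ← map_map, ← map_map, hx, toIso_inv_hom, map_hom_inv]
    have h1 := congrArg (ρ g) (hfix _ h2)
    rw [← Module.End.mul_apply, ← map_mul] at h1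
    rw [← Module.End.mul_apply, ← map_mul, ← h1]
    simp [mul_assoc]

/-- Some generic point exists and it is a generator. All generators are conjugate to it, and
genericity is constant on orbits. -/
theorem IsTypical.isGeneric_iff_isGenerator [CharZero K] (hT : HasTrivialIdempotents N)
    (hfin : ∀ i, Finite (N i)) (hM : Generates M) (hρ : ρ.IsIrreducible) (hF : IsLinearFunctor F)
    (h : IsTypical ρ F) {a : F.obj M} : IsGeneric ρ F a ↔ IsGenerator F a := by
  refine ⟨h.isGenerator hfin hρ hF, fun ha => ?_⟩
  obtain ⟨φ, hφ⟩ := h.1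
  obtain ⟨b, hb⟩ := exists_isGeneric hfin hρ hφ
  obtain ⟨X, p, hp⟩ := exists_cover hT hfin hM hF
  obtain ⟨g, rfl⟩ := (h.isGenerator hfin hρ hF hb).exists_aut hfin hp ha
  exact hb.map g

theorem isGenerator_of_iso (i : F ≅ homFun A M) : IsGenerator F (pt i.inv) := by
  intro Z z
  exact ⟨i.hom.app Z z, (app_eq i.inv _).symm.trans (Iso.hom_inv_id_app_apply i Z z)⟩

theorem stab_eq_bot_of_iso (i : F ≅ homFun A M) : stab F (pt i.inv) = ⊥ := by
  rw [Subgroup.eq_bot_iff_forall]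
  intro g hg
  rw [mem_stab, ← app_eq] at hg
  have h1 := congrArg (i.hom.app M) hg
  exact Iso.ext ((Iso.inv_hom_id_app_apply i M (toIso g).hom).symm.trans
    (h1.trans (Iso.inv_hom_id_app_apply i M (𝟙 M : M ⟶ M))))

/-- `pt i.inv` corresponds to the identity of `M`. The inverse of the automorphism attached to `g`
is precomposition with `g`, and it sends the identity to `g`, as `Hom(M, g)` does. -/
theorem map_pt_eq_inv_app (i : F ≅ homFun A M) (g : Aut M) :
    F.map (toIso g).hom (pt i.inv) =
      (toIso ((Aut.autMulEquivOfIso i).symm (yonedaAut A M g))).inv.app M (pt i.inv) := by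
  refine (app_eq i.inv _).symm.trans (congrArg (i.inv.app M) ?_)
  refine Eq.trans (Category.comp_id _).symm
    (congrArg ((homFunMap A (toIso g).hom).app M) ?_)
  exact (Iso.inv_hom_id_app_apply i M (𝟙 M : M ⟶ M)).symm

theorem IsGenerator.stab_eq_bot (hfin : ∀ i, Finite (N i)) {X : SumCat N} {p : homFun A X ⟶ F}
    (hp : IsCover p) {a : F.obj M} (ha : IsGenerator F a)
    (hcard : Nat.card (Aut F) = Nat.card (Aut M)) : stab F a = ⊥ := by
  have := finite_aut hfin M
  have h1 := ha.card_aut_mul_card_stab_le hfin hp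
  rw [hcard] at h1
  apply Subgroup.eq_bot_of_card_le
  exact Nat.le_of_mul_le_mul_left (by rwa [mul_one]) (Nat.card_pos (α := Aut M))

theorem card_aut_le (hfin : ∀ i, Finite (N i)) {X : SumCat N} {p : homFun A X ⟶ F}
    (hp : IsCover p) {a : F.obj M} (ha : IsGenerator F a) :
    Nat.card (Aut F) ≤ Nat.card (Aut M) := by
  have := finite_aut hfin M
  exact (Nat.le_mul_of_pos_right _ Nat.card_pos).trans (ha.card_aut_mul_card_stab_le hfin hp)

theorem finite_of_generates {M : SumCat N} (hMfin : Finite M.obj) {m : Fin n → ℕ}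
    (hm : ∀ i, 0 < m i) (e : M.obj ≃ₗ[R] ((i : Fin n) → (Fin (m i) → N i))) (i : Fin n) :
    Finite (N i) := by
  have : Finite ((i : Fin n) → (Fin (m i) → N i)) := Finite.of_equiv _ e.toEquiv
  classical
  refine Finite.of_surjective (fun x : (i : Fin n) → (Fin (m i) → N i) => x i ⟨0, hm i⟩) fun y => ?_
  exact ⟨Pi.single i fun _ => y, by simp⟩

theorem hasTrivialIdempotents_of_indecomposable (hN : ∀ i, Indecomposable (N i)) :
    HasTrivialIdempotents N := by
  intro i e he
  have he' : ModuleCat.ofHom e ≫ ModuleCat.ofHom e = ModuleCat.ofHom e := by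
    ext x
    exact LinearMap.congr_fun he x
  rcases (indecomposable_iff.1 (hN i)).2 (ModuleCat.ofHom e) he' with h | h
  · exact Or.inl (congrArg ModuleCat.Hom.hom h)
  · exact Or.inr (congrArg ModuleCat.Hom.hom h)

end Morphing

end FunctorMorphing

/-! ### Proof of the theorem over an arbitrary commutative base ring. -/

theorem functorMorphs_properties {A : Type w} [CommRing A] {R : Type u} [Ring R] [Algebra A R]
    {K : Type*} [Field K] [CharZero K]
    {n : ℕ} (N : Fin n → ModuleCat.{v} R) (hN : ∀ i, Indecomposable (N i))
    (M : SumCat N) (hMfin : Finite M.obj) (m : Fin n → ℕ) (hm : ∀ i, 0 < m i)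
    (hM : Nonempty (M.obj ≃ₗ[R] ((i : Fin n) → (Fin (m i) → N i))))
    {V : Type*} [AddCommGroup V] [Module K V] (ρ : Representation K (Aut M) V)
    (hρ : ρ.IsIrreducible)
    (F : SumCat N ⥤ ModuleCat.{v} A)
    {W : Type*} [AddCommGroup W] [Module K W] (σ : Representation K (Aut F) W)
    (h : FunctorMorphs ρ F σ) :
    degF σ ≤ degM ρ ∧
    (degF σ = degM ρ →
      Nonempty (F ≅ homFun _ M) ∧
      ∀ i : F ≅ homFun _ M, ∃ e : V ≃ₗ[K] W, ∀ (g : Aut M) (v : V),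
        e (ρ g v) = σ ((Aut.autMulEquivOfIso i).symm (yonedaAut _ M g)) (e v)) ∧
    (∃ a : F.obj M, ∀ b : F.obj M,
      IsGeneric ρ F b ↔ ∃ g : Aut M, F.map (toIso g).hom a = b) ∧
    (∀ a : F.obj M, IsGeneric ρ F a →
      ∃ e : W ≃ₗ[K] fixedSpace ρ (stab F a),
        ∀ (α : Aut F) (g : Aut M), F.map (toIso g).hom a = (toIso α).inv.app M a →
          ∀ w : W, (e (σ α w) : V) = ρ g (e w : V)) ∧
    (∃ (X Y : SumCat N) (f : X ⟶ Y) (p : homFun _ X ⟶ F),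
      IsMinimalPresentation f p) ∧
    (∀ (X Y : SumCat N) (f : X ⟶ Y) (p : homFun _ X ⟶ F),
      IsMinimalPresentation f p →
      IsDirectSummand X.obj M.obj ∧
      (∀ (φ : Aut F) (x : X ⟶ X),
        homFunMap _ x ≫ p = p ≫ (toIso φ).hom → IsIso x) ∧
      (∀ g : Y ⟶ X, IsIso (𝟙 X + f ≫ g)) ∧
      groupB f ≤ groupA p ∧
      (∃ (_ : ((groupB f).subgroupOf (groupA p)).Normal)
        (e : (groupA p ⧸
          (groupB f).subgroupOf (groupA p)) ≃* Aut F),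
        ∀ x : groupA p,
          homFunMap _ (toIso (x : Aut X)).inv ≫ p =
            p ≫ (toIso (e (QuotientGroup.mk x))).hom) ∧
      (degF σ = degM ρ →
        IsZero Y ∧ Nonempty (X ≅ M))) := by
  obtain ⟨hF, hV, ⟨E⟩⟩ := h
  obtain ⟨eM⟩ := hM
  have hfin := finite_of_generates hMfin hm eM
  have hT := hasTrivialIdempotents_of_indecomposable hN
  have hgen := generates_of_equiv hm eM
  obtain ⟨X, Y, f, p, hpres⟩ := exists_isMinimalPresentation hT hfin hgen hF
  have hp := hpres.isCover
  obtain ⟨φ, hφ⟩ := hV.1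
  obtain ⟨a, ha⟩ := exists_isGeneric hfin hρ hφ
  have hgg : ∀ {b : F.obj M}, IsGeneric ρ F b ↔ IsGenerator F b :=
    hV.isGeneric_iff_isGenerator hT hfin hgen hρ hF
  have horb : ∀ {b}, IsGeneric ρ F b → ∀ c, IsGeneric ρ F c →
      ∃ g : Aut M, F.map (toIso g).hom b = c :=
    fun hb c hc => (hgg.1 hb).exists_aut hfin hp (hgg.1 hc)
  have hequiv : ∀ b : F.obj M, IsGeneric ρ F b → ∃ e : W ≃ₗ[K] fixedSpace ρ (stab F b),
      ∀ (α : Aut F) (g : Aut M), F.map (toIso g).hom b = (toIso α).inv.app M b →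
        ∀ w : W, (e (σ α w) : V) = ρ g (e w : V) :=
    fun b hb => exists_equiv_fixedSpace hfin hρ hV E (horb hb)
  have hag := hgg.1 ha
  -- `V` embeds in `KF(M)`, which has finite dimension because `F(M)` is finite; comparing the
  -- `finrank` of `V^H` with that of `V` needs this.
  have hVfin : FiniteDimensional K V := by
    have := hF.finite M
    exact FiniteDimensional.of_injective φ.toLinearMap hφ
  have hdim : Module.finrank K W ≤ Module.finrank K V := by
    obtain ⟨e, -⟩ := hequiv a ha
    rw [e.finrank_eq]
    exact Submodule.finrank_le _
  have hcardle := card_aut_le hfin hp hag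
  have hstab := hag.stab_eq_bot hfin hp
  -- The lexicographic order compares supports only when the group orders agree. The stabiliser is
  -- then trivial and `F` is represented by a summand of `M`.
  have hsupp : Nat.card (Aut F) = Nat.card (Aut M) → supp F ≤ supp M.obj := by
    intro hc
    have := hp.isIso_of_stab_eq_bot hfin hgen hF hag (hstab hc)
    obtain ⟨s, t, hst, -, -⟩ := hp.exists_split hfin hag
    exact (supp_le_supp hT hfin (asIso p) ⟨s, t, hst⟩).1
  have hdeg : degF σ = degM ρ → Nat.card (Aut F) = Nat.card (Aut M) ∧ supp F = supp M.obj := by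
    intro hd
    have h1 : (toLex (Nat.card (Aut F), supp F) : ℕ ×ₗ ℕ) =
        toLex (Nat.card (Aut M), supp M.obj) := congrArg (fun x => (ofLex x).2) hd
    exact ⟨congrArg (fun x => (ofLex x).1) h1, congrArg (fun x => (ofLex x).2) h1⟩
  have heq : degF σ = degM ρ → ∀ {X : SumCat N} {p : homFun A X ⟶ F}, IsCover p →
      IsIso p ∧ Nonempty (X ≅ M) := by
    intro hd X p hp
    obtain ⟨h1, h2⟩ := hdeg hd
    have := hp.isIso_of_stab_eq_bot hfin hgen hF hag (hstab h1)
    obtain ⟨s, t, hst, hsa, -⟩ := hp.exists_split hfin hag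
    exact ⟨this, nonempty_iso_of_supp_eq hT hfin hF hst (by rw [hsa]; exact hstab h1) h2⟩
  refine ⟨?_, fun hd => ⟨?_, fun i => ?_⟩, ⟨a, fun b => ⟨horb ha b, ?_⟩⟩, hequiv,
    ⟨X, Y, f, p, hpres⟩, ?_⟩
  · rw [degF, degM, Prod.Lex.toLex_le_toLex]
    rcases hdim.lt_or_eq with h | h
    · exact Or.inl h
    · refine Or.inr ⟨h, ?_⟩
      rw [Prod.Lex.toLex_le_toLex]
      rcases hcardle.lt_or_eq with h | h
      · exact Or.inl h
      · exact Or.inr ⟨h, hsupp h⟩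
  · obtain ⟨h1, ⟨e⟩⟩ := heq hd hp
    exact ⟨(asIso p).symm.trans ((linearCoyoneda A (SumCat N)).mapIso e.symm.op)⟩
  -- Take as generic point the one corresponding to the identity of `M`. Its stabiliser is trivial,
  -- so its fixed space is all of `V`.
  · obtain ⟨e, he⟩ := hequiv _ (hgg.2 (isGenerator_of_iso i))
    have htop : fixedSpace ρ (stab F (pt i.inv)) = ⊤ := by
      rw [eq_top_iff]
      intro v _
      rw [mem_fixedSpace, stab_eq_bot_of_iso]
      intro g hg
      rw [Subgroup.mem_bot.1 hg, map_one, Module.End.one_apply]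
    refine ⟨(e.trans (LinearEquiv.ofTop _ htop)).symm, fun g v => ?_⟩
    obtain ⟨w, rfl⟩ := (e.trans (LinearEquiv.ofTop _ htop)).surjective v
    rw [LinearEquiv.symm_apply_apply, LinearEquiv.symm_apply_eq]
    exact (he _ g (map_pt_eq_inv_app i g) w).symm
  · rintro ⟨g, rfl⟩
    exact ha.map g
  · intro X Y f p hpres
    have hp := hpres.isCover
    refine ⟨?_, ?_, fun g => hp.isIso_of_map_pt hfin (map_pt_one_add hF hpres g),
      groupB_le_groupA hF hpres, exists_quotient_equiv hfin hF hpres, fun hd => ?_⟩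
    · obtain ⟨s, t, hst, -, -⟩ := hp.exists_split hfin hag
      exact isDirectSummand_iff.2 ⟨(⟨s, t, hst⟩ : Retract X M).map (IsSumOf N).ι⟩
    · intro ψ x hx
      exact hp.isIso_of_comp_eq hfin hx
    · obtain ⟨h1, h2⟩ := heq hd hp
      exact ⟨hpres.isZero_of_isIso h1, h2⟩

theorem theoremC {O : Type*} [CommRing O] [IsDomain O] [IsDiscreteValuationRing O]
    [IsAdicComplete (IsLocalRing.maximalIdeal O) O] [Finite (IsLocalRing.ResidueField O)] (ℓ : ℕ)
    {R : Type u} [Ring R] [Finite R] [Algebra (O ⧸ IsLocalRing.maximalIdeal O ^ ℓ) R]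
    {K : Type*} [Field K] [IsAlgClosed K] [CharZero K]
    {n : ℕ} (N : Fin n → ModuleCat.{v} R) (hN : ∀ i, Indecomposable (N i))
    (hNN : ∀ i j, i ≠ j → IsEmpty (N i ≅ N j))
    (M : SumCat N) (hMfin : Finite M.obj) (m : Fin n → ℕ) (hm : ∀ i, 0 < m i)
    (hM : Nonempty (M.obj ≃ₗ[R] ((i : Fin n) → (Fin (m i) → N i))))
    {V : Type*} [AddCommGroup V] [Module K V] (ρ : Representation K (Aut M) V)
    (hρ : ρ.IsIrreducible)
    (F : SumCat N ⥤ ModuleCat.{v} (O ⧸ IsLocalRing.maximalIdeal O ^ ℓ))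
    {W : Type*} [AddCommGroup W] [Module K W] (σ : Representation K (Aut F) W)
    (h : FunctorMorphs ρ F σ) :
    -- the degree does not increase
    degF σ ≤ degM ρ ∧
    -- if it stays the same, then `F ≅ F_M`, and `V ≅ W` under `Aut_R(M) ≅ Aut(F_M) ≅ Aut(F)`
    (degF σ = degM ρ →
      Nonempty (F ≅ homFun _ M) ∧
      ∀ i : F ≅ homFun _ M, ∃ e : V ≃ₗ[K] W, ∀ (g : Aut M) (v : V),
        e (ρ g v) = σ ((Aut.autMulEquivOfIso i).symm (yonedaAut _ M g)) (e v)) ∧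
    -- the generic points form exactly one orbit
    (∃ a : F.obj M, ∀ b : F.obj M,
      IsGeneric ρ F b ↔ ∃ g : Aut M, F.map (toIso g).hom a = b) ∧
    -- for a generic point `a` with stabiliser `H` the representation `W` is `V ^ H`, on which an
    -- automorphism `α` of `F` acts as any `g` in `Aut_R(M)` with `g a = α⁻¹ a` does
    (∀ a : F.obj M, IsGeneric ρ F a →
      ∃ e : W ≃ₗ[K] fixedSpace ρ (stab F a),
        ∀ (α : Aut F) (g : Aut M), F.map (toIso g).hom a = (toIso α).inv.app M a →
          ∀ w : W, (e (σ α w) : V) = ρ g (e w : V)) ∧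
    -- `F` has a minimal presentation `Hom(Y, -) ⟶ Hom(X, -) ⟶ F ⟶ 0`
    (∃ (X Y : SumCat N) (f : X ⟶ Y) (p : homFun _ X ⟶ F),
      IsMinimalPresentation f p) ∧
    -- for every such presentation:
    (∀ (X Y : SumCat N) (f : X ⟶ Y) (p : homFun _ X ⟶ F),
      IsMinimalPresentation f p →
      -- `X` is a direct summand of `M`
      IsDirectSummand X.obj M.obj ∧
      -- every endomorphism of `X` that lifts an automorphism of `F` is an automorphism
      (∀ (φ : Aut F) (x : X ⟶ X),
        homFunMap _ x ≫ p = p ≫ (toIso φ).hom → IsIso x) ∧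
      -- every `1 + g f` is an automorphism of `X`
      (∀ g : Y ⟶ X, IsIso (𝟙 X + f ≫ g)) ∧
      -- `B_F` is a normal subgroup of `A_F`, and `A_F / B_F ≅ Aut(F)`
      groupB f ≤ groupA p ∧
      (∃ (_ : ((groupB f).subgroupOf (groupA p)).Normal)
        (e : (groupA p ⧸
          (groupB f).subgroupOf (groupA p)) ≃* Aut F),
        ∀ x : groupA p,
          homFunMap _ (toIso (x : Aut X)).inv ≫ p =
            p ≫ (toIso (e (QuotientGroup.mk x))).hom) ∧
      -- if the degree stays the same, then `Y = 0` and `X ≅ M`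
      (degF σ = degM ρ →
        IsZero Y ∧ Nonempty (X ≅ M))) :=
  functorMorphs_properties N hN M hMfin m hm hM ρ hρ F σ h
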